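/- **Setting.** A tracial $\mathrm W^*$-algebra $\mathcal M=(M,\tau)$ is a $\mathrm W^*$-algebra $M$ with a faithful normal tracial state $\tau$; put $\|x\|_2=\tau(x^*x)^{1/2}$, $d(x,y)=\|x-y\|_2$, and let $D_r^{\mathcal M}$ ($r>0$) be the closed operator-norm ball of radius $r$. A $\mathrm W^*$-subalgebra is a unital $*$-subalgebra closed in the strong operator topology of the standard representation on $L^2(M,\tau)$; for $\mathbf X\in M^{\mathbb N}$, $\mathrm W^*(\mathbf X)$ is the strong operator closure of the unital $*$-algebra generated by $\mathbf X$. Formulas in the variables $(x_j)_{j\in\mathbb N}$ are built from the basic formulas $\operatorname{Re}\operatorname{tr}(t)$, $\operatorname{Im}\operatorname{tr}(t)$, $d(s,t)$, where $s,t$ are terms formed from variables, $0$, $1$, sums, products, adjoints, complex scalar multiples and non-commutative polynomials, by applying continuous functions $\mathbb R^n\to\mathbb R$ and the quantifiers $\sup_{x_j\in D_r}$ and $\inf_{x_j\in D_r}$; they are interpreted in $\mathcal M$ in the obvious way. The type $\operatorname{tp}^{\mathcal M}(\mathbf X)$ of $\mathbf X\in M^{\mathbb N}$ is the map $\phi\mapsto\phi^{\mathcal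 M}(\mathbf X)$ on formulas with free variables among the $x_j$. Let $\mathbb S$ be the set of all types of $\mathbb N$-tuples in tracial $\mathrm W^*$-algebras, and for $\mathbf r\in(0,\infty)^{\mathbb N}$ let $\mathbb S_{\mathbf r}$ be the set of types of tuples in $\prod_j D_{r_j}$, with the topology of pointwise convergence on formulas. A set $\mathcal O\subseteq\mathbb S$ is open if $\mathcal O\cap\mathbb S_{\mathbf r}$ is open in $\mathbb S_{\mathbf r}$ for every $\mathbf r$. **Entropy.** Fix a non-principal ultrafilter $\mathcal U$ on $\mathbb N$. Equip $M_n(\mathbb C)$ with its normalized trace. For $\mathcal K\subseteq\mathbb S$ let $\Gamma^{(n)}_{\mathbf r}(\mathcal K)$ be the set of $\mathbf X\in\prod_j D_{r_j}^{M_n(\mathbb C)}$ with $\operatorname{tp}^{M_n(\mathbb C)}(\mathbf X)\in\mathcal K$. For finite $F\subseteq\mathbb N$, $\epsilon>0$ and $\Omega\subseteq M_n(\mathbb C)^{\mathbb N}$, let $K^{\mathrm{orb}}_{F,\epsilon}(\Omega)$ be the minimal cardinality of a set $\Omega'\subseteq M_n(\mathbb C)^{\mathbb N}$ such that for every $\mathbf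 Y\in\Omega$ there are a unitary $U\in M_n(\mathbb C)$ and $\mathbf X\in\Omega'$ with $\|Y_i-UX_iU^*\|_2<\epsilon$ for all $i\in F$. Define, with $\log 0=-\infty$, $$\operatorname{Ent}^{\mathcal U}(\mathcal K)=\sup_{\mathbf r\in(0,\infty)^{\mathbb N}}\ \sup_{\substack{F\subseteq\mathbb N\text{ finite}\\ \epsilon>0}}\ \inf_{\substack{\mathcal O\supseteq\mathcal K\\ \mathcal O\text{ open}}}\ \lim_{n\to\mathcal U}\frac1{n^2}\log K^{\mathrm{orb}}_{F,\epsilon}\bigl(\Gamma^{(n)}_{\mathbf r}(\mathcal O)\bigr)\in[-\infty,\infty],$$ $\operatorname{Ent}^{\mathcal U}(\mu)=\operatorname{Ent}^{\mathcal U}(\{\mu\})$ for $\mu\in\mathbb S$, and, for $N\subseteq M$, $\operatorname{Ent}^{\mathcal U}(N:\mathcal M)=\sup_{\mathbf X\in N^{\mathbb N}}\operatorname{Ent}^{\mathcal U}(\operatorname{tp}^{\mathcal M}(\mathbf X))$. **Algebraicity.** Let $N\subseteq M$. A function $f:M\to\mathbb R$ is a definable predicate in $\mathcal M$ over $N$ if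 for all $r,\epsilon>0$ there are a formula $\psi(x,y_0,y_1,\dots)$ and $\mathbf Y\in N^{\mathbb N}$ with $|f(x)-\psi^{\mathcal M}(x,\mathbf Y)|<\epsilon$ for all $x\in D_r^{\mathcal M}$. An element $a\in M$ is algebraic over $N$ in $\mathcal M$ if there is a set $A\subseteq M$, compact for $d$, with $a\in A$, such that $x\mapsto d(x,A)$ is a definable predicate in $\mathcal M$ over $N$. Let $\operatorname{acl}(N)$ be the set of elements of $M$ that are algebraic over $N$ in $\mathcal M$. **Theorem.** Let $\mathcal U$ be a non-principal ultrafilter on $\mathbb N$ and $\mathcal M=(M,\tau)$ a tracial $\mathrm W^*$-algebra. 1. Let $\mathbf X\in M^{\mathbb N}$ and let $Y\in M$ be algebraic over $\mathrm W^*(\mathbf X)$ in $\mathcal M$. Then, with $(Y,\mathbf X)=(Y,X_0,X_1,\dots)$, $$\operatorname{Ent}^{\mathcal U}(\operatorname{tp}^{\mathcal M}(Y,\mathbf X))=\operatorname{Ent}^{\mathcal U}(\operatorname{tp}^{\mathcal M}(\mathbf X)).$$ 2. For every $\mathrm W^*$-subalgebra $N\subseteq M$, $$\operatorname{Ent}^{\mathcal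 U}(\operatorname{acl}(N):\mathcal M)=\operatorname{Ent}^{\mathcal U}(N:\mathcal M).$$ -/

import Mathlib

open scoped ComplexOrder Matrix.Norms.L2Operator Topology

universe u

noncomputable section

/-! ## Tracial W*-algebras -/

/-- A positive linear functional `τ` on a C*-algebra is a faithful normal tracial state.  Normality is
continuity for the weak-* topology coming from a predual (the predual is unique up to isometry). -/
structure IsFaithfulNormalTracialState {M : Type u} [CStarAlgebra M] [PartialOrder M]
    (τ : M →ₚ[ℂ] ℂ) : Prop where
  unital : τ 1 = 1
  tracial : ∀ x y : M, τ (x * y) = τ (y * x)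
  faithful : ∀ x : M, τ (star x * x) = 0 → x = 0
  normal : ∃ (P : Type u) (_ : NormedAddCommGroup P) (_ : NormedSpace ℂ P) (_ : CompleteSpace P)
    (e : StrongDual ℂ P ≃ₗᵢ⋆[ℂ] M), Continuous fun φ : WeakDual ℂ P => τ (e (WeakDual.toStrongDual φ))

/-- The closure of a subset of `M` for the strong operator topology of the standard (GNS)
representation on `L²(M, τ)`, i.e. for pointwise convergence of `x` acting as a function
`L²(M, τ) → L²(M, τ)`. -/
def sotClosure {M : Type u} [CStarAlgebra M] [PartialOrder M] [StarOrderedRing M]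
    (τ : M →ₚ[ℂ] ℂ) (A : Set M) : Set M :=
  {x | (τ.gnsStarAlgHom x : τ.GNS → τ.GNS) ∈
    closure ((fun a : M => (τ.gnsStarAlgHom a : τ.GNS → τ.GNS)) '' A)}

/-- `W*(X)`: the strong operator closure of the unital *-algebra generated by the tuple `X`. -/
def generatedWStar {M : Type u} [CStarAlgebra M] [PartialOrder M] [StarOrderedRing M]
    (τ : M →ₚ[ℂ] ℂ) (X : ℕ → M) : Set M :=
  sotClosure τ (StarAlgebra.adjoin ℂ (Set.range X) : Set M)

/-- A unital *-subalgebra that is closed in the strong operator topology. -/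
def IsWStarSubalgebra {M : Type u} [CStarAlgebra M] [PartialOrder M] [StarOrderedRing M]
    (τ : M →ₚ[ℂ] ℂ) (N : StarSubalgebra ℂ M) : Prop :=
  sotClosure τ (N : Set M) ⊆ (N : Set M)

/-! ## The language of tracial W*-algebras -/

/-- Terms in the variables `x₀, x₁, …`.  The constructor `poly p` is the function symbol `t_p` of the
noncommutative polynomial `p`. -/
inductive TrTerm : Type
  | var (i : ℕ) : TrTerm
  | zero : TrTerm
  | one : TrTerm
  | add (s t : TrTerm) : TrTerm
  | mul (s t : TrTerm) : TrTerm
  | adj (t : TrTerm) : TrTerm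
  | smul (c : ℂ) (t : TrTerm) : TrTerm
  | poly {d : ℕ} (p : FreeAlgebra ℂ (Fin d)) (t : Fin d → TrTerm) : TrTerm

/-- Formulas.  The basic formulas are the relation symbols `Re tr`, `Im tr` and the metric `d`
applied to terms; `conn` applies a continuous connective; `sup r i φ` and `inf r i φ` quantify the
variable `xᵢ` over the domain `D_r`. -/
inductive TrFormula : Type
  | reTr (t : TrTerm) : TrFormula
  | imTr (t : TrTerm) : TrFormula
  | dist (s t : TrTerm) : TrFormula
  | conn {n : ℕ} (F : C(Fin n → ℝ, ℝ)) (φ : Fin n → TrFormula) : TrFormula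
  | sup (r : ℝ) (hr : 0 < r) (i : ℕ) (φ : TrFormula) : TrFormula
  | inf (r : ℝ) (hr : 0 < r) (i : ℕ) (φ : TrFormula) : TrFormula

/-- Interpretation of a term at an assignment `v` of the variables. -/
def TrTerm.eval {M : Type u} [CStarAlgebra M] (v : ℕ → M) : TrTerm → M
  | .var i => v i
  | .zero => 0
  | .one => 1
  | .add s t => s.eval v + t.eval v
  | .mul s t => s.eval v * t.eval v
  | .adj t => star (t.eval v)
  | .smul c t => c • t.eval v
  | .poly p t => FreeAlgebra.lift ℂ (fun k => (t k).eval v) p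

/-- `‖x‖₂ = τ(x* x)^{1/2}`. -/
def traceNorm2 {M : Type u} [CStarAlgebra M] (τ : M → ℂ) (x : M) : ℝ :=
  √(τ (star x * x)).re

/-- Interpretation of a formula at an assignment `v` of the variables; `D_r` is the closed operator
norm ball of radius `r`. -/
def TrFormula.eval {M : Type u} [CStarAlgebra M] (τ : M → ℂ) : TrFormula → (ℕ → M) → ℝ
  | .reTr t, v => (τ (t.eval v)).re
  | .imTr t, v => (τ (t.eval v)).im
  | .dist s t, v => traceNorm2 τ (s.eval v - t.eval v)
  | .conn F φ, v => F fun k => (φ k).eval τ v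
  | .sup r _ i φ, v => ⨆ z : {z : M // ‖z‖ ≤ r}, φ.eval τ (Function.update v i z)
  | .inf r _ i φ, v => ⨅ z : {z : M // ‖z‖ ≤ r}, φ.eval τ (Function.update v i z)

/-! ## Types -/

/-- `tp^M(X)`, as a function on formulas. -/
def formulaType {M : Type u} [CStarAlgebra M] (τ : M → ℂ) (X : ℕ → M) : TrFormula → ℝ :=
  fun φ => φ.eval τ X

/-- Sequences of radii. -/
abbrev Radii : Type := {r : ℕ → ℝ // ∀ j, 0 < r j}

/-- `X ∈ ∏ⱼ D_{rⱼ}`. -/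
def InDomain {M : Type u} [CStarAlgebra M] (r : Radii) (X : ℕ → M) : Prop :=
  ∀ j, ‖X j‖ ≤ r.1 j

/-- The space `𝕊(T_tr)` of types of `ℕ`-tuples in tracial W*-algebras. -/
def TypeSpace : Type :=
  {μ : TrFormula → ℝ // ∃ (M : Type u) (_ : CStarAlgebra M) (_ : PartialOrder M)
    (_ : StarOrderedRing M) (_ : WStarAlgebra M) (τ : M →ₚ[ℂ] ℂ) (X : ℕ → M),
    IsFaithfulNormalTracialState τ ∧ μ = formulaType τ X}

/-- The set `𝕊_r(T_tr)` of types of tuples from `∏ⱼ D_{rⱼ}`. -/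
def TypeSpace.bounded (r : Radii) : Set TypeSpace.{u} :=
  {μ | ∃ (M : Type u) (_ : CStarAlgebra M) (_ : PartialOrder M)
    (_ : StarOrderedRing M) (_ : WStarAlgebra M) (τ : M →ₚ[ℂ] ℂ) (X : ℕ → M),
    IsFaithfulNormalTracialState τ ∧ InDomain r X ∧ μ.1 = formulaType τ X}

/-- The weak-* topology on `𝕊_r(T_tr)`: pointwise convergence on formulas. -/
@[reducible]
def TypeSpace.boundedTopology (r : Radii) :
    TopologicalSpace ↥(TypeSpace.bounded.{u} r) :=
  TopologicalSpace.induced (fun μ => (μ.1.1 : TrFormula → ℝ)) inferInstance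

/-- The logic topology: `O` is open iff `O ∩ 𝕊_r(T_tr)` is open in `𝕊_r(T_tr)` for every `r`. -/
instance TypeSpace.logicTopology : TopologicalSpace TypeSpace.{u} :=
  ⨆ r : Radii, TopologicalSpace.coinduced
    (Subtype.val : ↥(TypeSpace.bounded.{u} r) → TypeSpace.{u}) (TypeSpace.boundedTopology.{u} r)

/-- The type of a tuple of a tracial W*-algebra as a point of the type space. -/
def typeOf {M : Type u} [CStarAlgebra M] [PartialOrder M] [StarOrderedRing M] [WStarAlgebra M]
    {τ : M →ₚ[ℂ] ℂ} (hτ : IsFaithfulNormalTracialState τ) (X : ℕ → M) : TypeSpace.{u} :=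
  ⟨formulaType τ X, M, inferInstance, inferInstance, inferInstance, inferInstance, τ, X, hτ, rfl⟩

/-! ## Covering entropy -/

/-- The normalized trace on `M_n(ℂ)`. -/
def matTr (n : ℕ) (A : Matrix (Fin n) (Fin n) ℂ) : ℂ := (n : ℂ)⁻¹ * A.trace

/-- The microstate space `Γ_r^{(n)}(K)`. -/
def microstates (n : ℕ) (r : Radii) (K : Set TypeSpace.{u}) :
    Set (ℕ → Matrix (Fin n) (Fin n) ℂ) :=
  {X | InDomain r X ∧ ∃ μ ∈ K, μ.1 = formulaType (matTr n) X}

/-- The orbital neighborhood `N^orb_{F,ε}(Ω)`. -/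
def orbNhd {n : ℕ} (F : Finset ℕ) (ε : ℝ) (Ω : Set (ℕ → Matrix (Fin n) (Fin n) ℂ)) :
    Set (ℕ → Matrix (Fin n) (Fin n) ℂ) :=
  {Y | ∃ V ∈ Matrix.unitaryGroup (Fin n) ℂ, ∃ X ∈ Ω, ∀ i ∈ F,
    traceNorm2 (matTr n) (Y i - V * X i * star V) < ε}

/-- The orbital covering number `K^orb_{F,ε}(Ω)`. -/
def orbCoveringNumber {n : ℕ} (F : Finset ℕ) (ε : ℝ)
    (Ω : Set (ℕ → Matrix (Fin n) (Fin n) ℂ)) : ℕ∞ :=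
  ⨅ (Ω' : Set (ℕ → Matrix (Fin n) (Fin n) ℂ)) (_ : Ω ⊆ orbNhd F ε Ω'), Ω'.encard

/-- `Ent^U_{r,F,ε}(K)`, with `log 0 = -∞`. -/
def entAt (U : Ultrafilter ℕ) (r : Radii) (F : Finset ℕ) (ε : ℝ) (K : Set TypeSpace.{u}) : EReal :=
  ⨅ (O : Set TypeSpace.{u}) (_ : IsOpen O) (_ : K ⊆ O),
    (U.map fun n : ℕ => ((1 / (n : ℝ) ^ 2 : ℝ) : EReal) *
      ENNReal.log (orbCoveringNumber F ε (microstates n r O) : ENNReal)).lim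

/-- `Ent^U_r(K)`. -/
def entRadius (U : Ultrafilter ℕ) (r : Radii) (K : Set TypeSpace.{u}) : EReal :=
  ⨆ (F : Finset ℕ) (ε : ℝ) (_ : 0 < ε), entAt U r F ε K

/-- `Ent^U(K)`. -/
def Ent (U : Ultrafilter ℕ) (K : Set TypeSpace.{u}) : EReal :=
  ⨆ r : Radii, entRadius U r K

/-- `Ent^U(N : M)`, the supremum of `Ent^U(tp^M(X))` over `ℕ`-tuples `X` from `N`. -/
def EntIn {M : Type u} [CStarAlgebra M] [PartialOrder M] [StarOrderedRing M] [WStarAlgebra M]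
    (U : Ultrafilter ℕ) {τ : M →ₚ[ℂ] ℂ} (hτ : IsFaithfulNormalTracialState τ) (N : Set M) : EReal :=
  ⨆ (X : ℕ → M) (_ : ∀ j, X j ∈ N), Ent U {typeOf hτ X}

/-! ## Algebraicity -/

/-- The tuple `(a, X₀, X₁, …)`. -/
def consTuple {M : Type u} (a : M) (X : ℕ → M) : ℕ → M
  | 0 => a
  | j + 1 => X j

/-- `f` is a definable predicate (in one variable) in `M` over `N`. -/
def IsDefinablePredicateOver {M : Type u} [CStarAlgebra M] (τ : M → ℂ) (N : Set M)
    (f : M → ℝ) : Prop :=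
  ∀ r : ℝ, 0 < r → ∀ ε : ℝ, 0 < ε → ∃ (ψ : TrFormula) (Y : ℕ → M), (∀ j, Y j ∈ N) ∧
    ∀ x : M, ‖x‖ ≤ r → |f x - ψ.eval τ (consTuple x Y)| < ε

/-- `a` is algebraic over `N` in `M`: it lies in a compact set `A` such that `x ↦ d(x, A)` is definable
over `N`.  The metric space is `M` with the distance of `‖·‖₂`, which Mathlib calls `τ.PreGNS`. -/
def IsAlgebraicOver {M : Type u} [CStarAlgebra M] [PartialOrder M] [StarOrderedRing M]
    (τ : M →ₚ[ℂ] ℂ) (N : Set M) (a : M) : Prop :=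
  ∃ A : Set τ.PreGNS, IsCompact A ∧ τ.toPreGNS a ∈ A ∧
    IsDefinablePredicateOver τ N fun x => Metric.infDist (τ.toPreGNS x) A

/-- The algebraic closure of `N` in `M`. -/
def acl {M : Type u} [CStarAlgebra M] [PartialOrder M] [StarOrderedRing M]
    (τ : M →ₚ[ℂ] ℂ) (N : Set M) : Set M :=
  {a | IsAlgebraicOver τ N a}

end

universe v

/-! Everything reduces to one inequality, `Ent_le_of_isAlgebraicVia`: if every `X i` lies in a
compact set whose distance function is given by formulas with parameters `Z`, then the entropy of
the type of `X` is at most that of `Z`. Coordinates of a tuple and elements of `generatedWStar τ Z`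
are algebraic via singletons, and countably many algebraic elements share one sequence of parameters
(`exists_isAlgebraicVia`), so both statements follow by applying the inequality in each direction.

The inequality is a counting argument. A compact set is covered by finitely many small balls, so for
some `N` the near-solutions `y` of `ψ(y, Z) < 2η` do not contain `N + 1` separated points
(`exists_noSeparatedSolutions`). This absence is a first-order statement up to a small error, so it
passes to matrices. For a neighborhood `O` of the type of `Z`, the condition "some `Z'` in a fixed
box has `φ(Z') < 0`, where `φ < 0` forces its type into `O`, and each `X i` with `i ∈ F` is a
near-solution over `Z'`, with few separated ones" defines a neighborhood of the type of `X`. Every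
matrix tuple satisfying it comes with a microstate of `O`, and over that microstate only boundedly
many choices of each `X i` exist up to `ε`.

Hence a cover of the microstates of `Z` yields one of the microstates of `X`, larger by a factor
independent of `n` (`orbCoveringNumber_le_mul`); the factor disappears after taking logarithms and
dividing by `n²`. Moving from one parameter tuple to a nearby one uses the continuity of formulas
uniformly over all algebras (`TrFormula.bounded_and_uniform`). Radii too small to contain `X`
contribute `-∞` (`entAt_typeOf_eq_bot`). -/

/-- The properties of a tracial state that are used to estimate formulas. -/
structure IsTraceLike {M : Type u} [CStarAlgebra M] (τ : M → ℂ) : Prop where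
  map_zero : τ 0 = 0
  map_sub : ∀ x y, τ (x - y) = τ x - τ y
  norm_le : ∀ x, ‖τ x‖ ≤ traceNorm2 τ x
  add_le : ∀ x y, traceNorm2 τ (x + y) ≤ traceNorm2 τ x + traceNorm2 τ y
  smul_le : ∀ (c : ℂ) x, traceNorm2 τ (c • x) ≤ ‖c‖ * traceNorm2 τ x
  star_le : ∀ x, traceNorm2 τ (star x) ≤ traceNorm2 τ x
  le_norm : ∀ x, traceNorm2 τ x ≤ ‖x‖
  mul_le : ∀ x y, traceNorm2 τ (x * y) ≤ ‖x‖ * traceNorm2 τ y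
  eq_zero : ∀ x, traceNorm2 τ x = 0 → x = 0

lemma traceNorm2_nonneg {M : Type u} [CStarAlgebra M] (τ : M → ℂ) (x : M) :
    0 ≤ traceNorm2 τ x := Real.sqrt_nonneg _

section
variable {M : Type u} [CStarAlgebra M] [PartialOrder M] [StarOrderedRing M] {τ : M →ₚ[ℂ] ℂ}

lemma traceNorm2_eq_norm (x : M) : traceNorm2 τ x = ‖τ.toPreGNS x‖ := by
  rw [PositiveLinearMap.preGNS_norm_def]; rfl

lemma traceNorm2_sub_eq_dist (x y : M) :
    traceNorm2 τ (x - y) = dist (τ.toPreGNS x) (τ.toPreGNS y) := by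
  rw [traceNorm2_eq_norm, map_sub, dist_eq_norm]

lemma traceNorm2_mul_le (x y : M) : traceNorm2 τ (x * y) ≤ ‖x‖ * traceNorm2 τ y := by
  rw [traceNorm2_eq_norm, traceNorm2_eq_norm]
  have h := (τ.leftMulMapPreGNS x).le_opNorm (τ.toPreGNS y)
  refine h.trans ?_
  gcongr
  exact LinearMap.mkContinuous_norm_le _ (norm_nonneg _) _

lemma IsFaithfulNormalTracialState.isTraceLike (hτ : IsFaithfulNormalTracialState τ) :
    IsTraceLike (τ : M → ℂ) := by
  have h1 : traceNorm2 τ 1 = 1 := by simp [traceNorm2, hτ.unital]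
  refine ⟨map_zero τ, map_sub τ, fun x => ?_, fun x y => ?_, fun c x => ?_, fun x => ?_,
    fun x => ?_, traceNorm2_mul_le, fun x hx => ?_⟩
  · have := norm_inner_le_norm (𝕜 := ℂ) (τ.toPreGNS 1) (τ.toPreGNS x)
    rw [← traceNorm2_eq_norm, ← traceNorm2_eq_norm, h1, one_mul,
      PositiveLinearMap.preGNS_inner_def] at this
    simpa using this
  · simp only [traceNorm2_eq_norm, map_add]; exact norm_add_le _ _
  · simp only [traceNorm2_eq_norm, map_smul]; exact (norm_smul c _).le
  · simp only [traceNorm2, star_star, hτ.tracial x]; rfl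
  · simpa [h1] using traceNorm2_mul_le (τ := τ) x 1
  · refine hτ.faithful x ?_
    have := PositiveLinearMap.preGNS_norm_sq τ (τ.toPreGNS x)
    rw [← traceNorm2_eq_norm, hx] at this
    simpa using this.symm

end

namespace IsTraceLike
variable {M : Type u} [CStarAlgebra M] {τ : M → ℂ}

lemma zero (h : IsTraceLike τ) : traceNorm2 τ 0 = 0 := by simp [traceNorm2, h.map_zero]

end IsTraceLike

/-! ### Matrix algebras as tracial W*-algebras -/

/-- A finite-dimensional C*-algebra is linearly and isometrically the dual of its dual. -/
lemma exists_predual_of_finiteDimensional (A : Type u) [CStarAlgebra A] [FiniteDimensional ℂ A] :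
    Nonempty (StrongDual ℂ (StrongDual ℂ A) ≃ₗᵢ⋆[ℂ] A) := by
  have hd : ∀ (E : Type u) [NormedAddCommGroup E] [NormedSpace ℂ E] [FiniteDimensional ℂ E],
      Module.finrank ℂ E = Module.finrank ℂ (StrongDual ℂ E) := fun E _ _ _ =>
    (Subspace.dual_finrank_eq (K := ℂ) (V := E)).symm.trans
      (LinearMap.toContinuousLinearMap (𝕜 := ℂ) (E := E) (F' := ℂ)).finrank_eq
  have h : Module.finrank ℂ A = Module.finrank ℂ (StrongDual ℂ (StrongDual ℂ A)) :=
    (hd A).trans (hd _)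
  -- The canonical map into the double dual is complex linear; composing with the adjoint gives the
  -- conjugate-linear isometry asked for.
  exact ⟨((NormedSpace.inclusionInDoubleDualLi (E := A) ℂ).toLinearIsometryEquiv h).symm.trans
    (starₗᵢ ℂ : A ≃ₗᵢ⋆[ℂ] A)⟩

lemma trace_star_mul_self {ι : Type u} [Fintype ι] (A : Matrix ι ι ℂ) :
    (star A * A).trace = ((∑ i, ∑ j, ‖A j i‖ ^ 2 : ℝ) : ℂ) := by
  simp [Matrix.trace, Matrix.mul_apply, Matrix.star_apply, ← Complex.normSq_eq_conj_mul_self,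
    Complex.normSq_eq_norm_sq]

/-- Normality is automatic because every linear functional on a finite-dimensional space is
continuous. The index type lives in `Type u` so that the algebra can realize points of
`TypeSpace.{u}`. -/
lemma exists_normalizedTrace (ι : Type u) [Fintype ι] [DecidableEq ι] [Nonempty ι] :
    ∃ (_ : PartialOrder (Matrix ι ι ℂ)) (_ : StarOrderedRing (Matrix ι ι ℂ))
      (_ : WStarAlgebra (Matrix ι ι ℂ)) (τ : Matrix ι ι ℂ →ₚ[ℂ] ℂ),
      (∀ A, τ A = (Fintype.card ι : ℂ)⁻¹ * A.trace) ∧ IsFaithfulNormalTracialState τ := by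
  let _ : PartialOrder (Matrix ι ι ℂ) := CStarAlgebra.spectralOrder _
  have : StarOrderedRing (Matrix ι ι ℂ) := CStarAlgebra.spectralOrderedRing _
  obtain ⟨e⟩ := exists_predual_of_finiteDimensional (Matrix ι ι ℂ)
  have hc : (0 : ℝ) < Fintype.card ι := by exact_mod_cast Fintype.card_pos
  let f : Matrix ι ι ℂ →ₗ[ℂ] ℂ := (Fintype.card ι : ℂ)⁻¹ • Matrix.traceLinearMap ι ℂ ℂ
  have hf : ∀ A, f A = (Fintype.card ι : ℂ)⁻¹ * A.trace := fun A => rfl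
  have hfs : ∀ A, f (star A * A) =
      (((Fintype.card ι : ℝ)⁻¹ * ∑ i, ∑ j, ‖A j i‖ ^ 2 : ℝ) : ℂ) := fun A => by
    rw [hf, trace_star_mul_self]; push_cast; rfl
  let τ : Matrix ι ι ℂ →ₚ[ℂ] ℂ := PositiveLinearMap.mk₀ f fun A hA => by
    obtain ⟨B, rfl⟩ := CStarAlgebra.nonneg_iff_eq_star_mul_self.mp hA
    rw [hfs]
    exact_mod_cast mul_nonneg (inv_nonneg.2 hc.le) (by positivity)
  have hτ : ∀ A, τ A = f A := fun A => rfl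
  refine ⟨inferInstance, inferInstance, ⟨_, inferInstance, inferInstance, inferInstance, ⟨e⟩⟩, τ,
    hf, ⟨?_, ?_, ?_, ⟨_, inferInstance, inferInstance, inferInstance, e, ?_⟩⟩⟩
  · rw [hτ, hf, Matrix.trace_one, inv_mul_cancel₀]
    exact_mod_cast hc.ne'
  · intro x y
    rw [hτ, hτ, hf, hf, Matrix.trace_mul_comm]
  · intro x hx
    rw [hτ, hfs, Complex.ofReal_eq_zero, mul_eq_zero, or_iff_right (inv_ne_zero hc.ne'),
      Finset.sum_eq_zero_iff_of_nonneg fun i _ => by positivity] at hx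
    ext j i
    have h1 := hx i (Finset.mem_univ _)
    rw [Finset.sum_eq_zero_iff_of_nonneg fun i _ => by positivity] at h1
    simpa using h1 j (Finset.mem_univ _)
  · have hd : ∀ (E : Type u) [NormedAddCommGroup E] [NormedSpace ℂ E] [FiniteDimensional ℂ E],
      FiniteDimensional ℂ (StrongDual ℂ E) := fun E _ _ _ =>
        (LinearMap.toContinuousLinearMap (𝕜 := ℂ) (E := E) (F' := ℂ)).finiteDimensional
    have : FiniteDimensional ℂ (WeakDual ℂ (StrongDual ℂ (Matrix ι ι ℂ))) :=
      haveI := hd (Matrix ι ι ℂ)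
      hd (StrongDual ℂ (Matrix ι ι ℂ))
    -- As `e` is conjugate-linear, the conjugate of `τ ∘ e` is the linear map.
    let g : WeakDual ℂ (StrongDual ℂ (Matrix ι ι ℂ)) →ₗ[ℂ] ℂ :=
      { toFun := fun φ => star (τ (e (WeakDual.toStrongDual φ)))
        map_add' := by intro a b; simp
        map_smul' := by intro a b; rw [map_smul, e.map_smulₛₗ, map_smul]; simp }
    have := (LinearMap.continuous_of_finiteDimensional
      (E := WeakDual ℂ (StrongDual ℂ (Matrix ι ι ℂ))) g).star
    simpa [g] using this

lemma isTraceLike_matTr (n : ℕ) [NeZero n] : IsTraceLike (matTr n) := by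
  obtain ⟨_, _, _, τ, h, hτ⟩ := exists_normalizedTrace (Fin n)
  have : (τ : Matrix (Fin n) (Fin n) ℂ → ℂ) = matTr n := by ext A; simp [h, matTr]
  exact this ▸ hτ.isTraceLike

/-! ### Invariance under isomorphisms -/

lemma TrTerm.eval_map {M : Type u} {M' : Type v} [CStarAlgebra M] [CStarAlgebra M']
    (e : M ≃⋆ₐ[ℂ] M') (w : ℕ → M) (t : TrTerm) : t.eval (fun i => e (w i)) = e (t.eval w) := by
  induction t with
  | var i => rfl
  | zero => simp [TrTerm.eval]
  | one => simp [TrTerm.eval]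
  | add s t hs ht => simp [TrTerm.eval, hs, ht]
  | mul s t hs ht => simp [TrTerm.eval, hs, ht]
  | adj t ht => simp [TrTerm.eval, ht, map_star]
  | smul c t ht => simp [TrTerm.eval, ht]
  | poly p t ht =>
    simp only [TrTerm.eval, ht]
    have : FreeAlgebra.lift ℂ (fun k => e ((t k).eval w)) =
        ((e : M ≃⋆ₐ[ℂ] M').toAlgEquiv : M →ₐ[ℂ] M').comp
          (FreeAlgebra.lift ℂ (fun k => (t k).eval w)) := by
      ext k; simp
    rw [this]; simp

/-- Isomorphisms are isometric, so they map the quantifier domains onto each other. This serves both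
for changing the universe of a matrix algebra and for unitary conjugation. -/
lemma TrFormula.eval_map {M : Type u} {M' : Type v} [CStarAlgebra M] [CStarAlgebra M']
    {τ : M → ℂ} {τ' : M' → ℂ} (e : M ≃⋆ₐ[ℂ] M') (he : ∀ x, τ' (e x) = τ x) (φ : TrFormula) :
    ∀ w : ℕ → M, φ.eval τ' (fun i => e (w i)) = φ.eval τ w := by
  have hup : ∀ (w : ℕ → M) (i : ℕ) (z : M),
      Function.update (fun i => e (w i)) i (e z) = fun j => e (Function.update w i z j) := by
    intro w i z; ext j; by_cases h : j = i
    · subst h; simp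
    · simp [h]
  have hball : ∀ (r : ℝ), Function.Surjective
      (fun z : {z : M // ‖z‖ ≤ r} => (⟨e z, by rw [StarAlgEquiv.norm_map]; exact z.2⟩ :
        {z : M' // ‖z‖ ≤ r})) := by
    intro r z
    refine ⟨⟨e.symm z, by rw [StarAlgEquiv.norm_map]; exact z.2⟩, ?_⟩
    ext; simp
  induction φ with
  | reTr t => intro w; simp [TrFormula.eval, TrTerm.eval_map, he]
  | imTr t => intro w; simp [TrFormula.eval, TrTerm.eval_map, he]
  | dist s t =>
    intro w
    simp only [TrFormula.eval, TrTerm.eval_map, traceNorm2]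
    rw [← map_sub, ← map_star, ← map_mul, he]
  | conn F φ ih => intro w; simp [TrFormula.eval, ih]
  | sup r hr i φ ih =>
    intro w
    simp only [TrFormula.eval]
    rw [← (hball r).iSup_comp]
    simp only [hup, ih]
  | inf r hr i φ ih =>
    intro w
    simp only [TrFormula.eval]
    rw [← (hball r).iInf_comp]
    simp only [hup, ih]

/-! ### Renaming of variables -/

/-- Renaming of the variables of a term. -/
def TrTerm.rename (σ : ℕ → ℕ) : TrTerm → TrTerm
  | .var i => .var (σ i)
  | .zero => .zero
  | .one => .one
  | .add s t => .add (s.rename σ) (t.rename σ)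
  | .mul s t => .mul (s.rename σ) (t.rename σ)
  | .adj t => .adj (t.rename σ)
  | .smul c t => .smul c (t.rename σ)
  | .poly p t => .poly p fun k => (t k).rename σ

/-- Renaming of the free and bound variables of a formula. -/
def TrFormula.rename (σ : ℕ → ℕ) : TrFormula → TrFormula
  | .reTr t => .reTr (t.rename σ)
  | .imTr t => .imTr (t.rename σ)
  | .dist s t => .dist (s.rename σ) (t.rename σ)
  | .conn F φ => .conn F fun k => (φ k).rename σ
  | .sup r hr i φ => .sup r hr (σ i) (φ.rename σ)
  | .inf r hr i φ => .inf r hr (σ i) (φ.rename σ)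

lemma TrTerm.eval_rename {M : Type u} [CStarAlgebra M] (σ : ℕ → ℕ) (w : ℕ → M) (t : TrTerm) :
    (t.rename σ).eval w = t.eval (w ∘ σ) := by
  induction t <;> simp_all [TrTerm.eval, TrTerm.rename]

/-- Bound variables are renamed too; injectivity of `σ` prevents capture. -/
lemma TrFormula.eval_rename {M : Type u} [CStarAlgebra M] {τ : M → ℂ} {σ : ℕ → ℕ}
    (hσ : Function.Injective σ) (φ : TrFormula) :
    ∀ w : ℕ → M, (φ.rename σ).eval τ w = φ.eval τ (w ∘ σ) := by
  induction φ with
  | reTr t => intro w; simp [TrFormula.eval, TrFormula.rename, TrTerm.eval_rename]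
  | imTr t => intro w; simp [TrFormula.eval, TrFormula.rename, TrTerm.eval_rename]
  | dist s t => intro w; simp [TrFormula.eval, TrFormula.rename, TrTerm.eval_rename]
  | conn F φ ih => intro w; simp [TrFormula.eval, TrFormula.rename, ih]
  | sup r hr i φ ih =>
    intro w
    simp only [TrFormula.eval, TrFormula.rename, ih, Function.update_comp_eq_of_injective _ hσ]
  | inf r hr i φ ih =>
    intro w
    simp only [TrFormula.eval, TrFormula.rename, ih, Function.update_comp_eq_of_injective _ hσ]

/-! ### Uniform continuity -/

/-- A bound for the indices of the variables of a term. -/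
def TrTerm.width : TrTerm → ℕ
  | .var i => i + 1
  | .zero => 0
  | .one => 0
  | .add s t => max s.width t.width
  | .mul s t => max s.width t.width
  | .adj t => t.width
  | .smul _ t => t.width
  | .poly _ t => Finset.univ.sup fun k => (t k).width

/-- A bound for the indices of the free and bound variables of a formula. -/
def TrFormula.width : TrFormula → ℕ
  | .reTr t => t.width
  | .imTr t => t.width
  | .dist s t => max s.width t.width
  | .conn _ φ => Finset.univ.sup fun k => (φ k).width
  | .sup _ _ i φ => max (i + 1) φ.width
  | .inf _ _ i φ => max (i + 1) φ.width

namespace IsTraceLike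

variable {M : Type u} [CStarAlgebra M] {τ : M → ℂ} (h : IsTraceLike τ)
include h

lemma neg_le (x : M) : traceNorm2 τ (-x) ≤ traceNorm2 τ x := by
  simpa using h.smul_le (-1) x

lemma sub_comm (x y : M) : traceNorm2 τ (x - y) = traceNorm2 τ (y - x) :=
  le_antisymm (by simpa using h.neg_le (y - x)) (by simpa using h.neg_le (x - y))

lemma sub_le (x y z : M) :
    traceNorm2 τ (x - z) ≤ traceNorm2 τ (x - y) + traceNorm2 τ (y - z) := by
  simpa using h.add_le (x - y) (y - z)

/-- Taking adjoints turns right multiplication into left multiplication. -/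
lemma mul_le' (x y : M) : traceNorm2 τ (x * y) ≤ traceNorm2 τ x * ‖y‖ := by
  have h1 := h.star_le (star (x * y))
  have h2 := h.mul_le (star y) (star x)
  have h3 := mul_le_mul_of_nonneg_left (h.star_le x) (norm_nonneg y)
  rw [star_star, star_mul] at h1
  rw [norm_star] at h2
  linarith

end IsTraceLike

/-- A family of functions on the tuples of all tracial C*-algebras that is bounded and Lipschitz on
bounded sets, uniformly in the algebra, and depends on the first `m` variables only. -/
def IsTame (m : ℕ) (f : ∀ (M : Type u) [CStarAlgebra M], (ℕ → M) → M) : Prop :=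
  ∀ r : ℕ → ℝ, ∃ C : ℝ, 0 ≤ C ∧ ∀ (M : Type u) [CStarAlgebra M] (τ : M → ℂ), IsTraceLike τ →
    ∀ x : ℕ → M, (∀ j, ‖x j‖ ≤ r j) → ‖f M x‖ ≤ C ∧ ∀ y : ℕ → M, (∀ j, ‖y j‖ ≤ r j) →
      ∀ δ : ℝ, 0 ≤ δ → (∀ i < m, traceNorm2 τ (x i - y i) ≤ δ) →
        traceNorm2 τ (f M x - f M y) ≤ C * δ

namespace IsTame

variable {m : ℕ} {f g : ∀ (M : Type u) [CStarAlgebra M], (ℕ → M) → M}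

lemma mono {m' : ℕ} (hf : IsTame m f) (h : m ≤ m') : IsTame m' f := fun r => by
  obtain ⟨C, hC, H⟩ := hf r
  exact ⟨C, hC, fun M _ τ hτ x hx => ⟨(H M τ hτ x hx).1, fun y hy δ hδ hd =>
    (H M τ hτ x hx).2 y hy δ hδ fun i hi => hd i (hi.trans_le h)⟩⟩

lemma var {i : ℕ} (hi : i < m) : IsTame m fun (M : Type u) [CStarAlgebra M] (x : ℕ → M) => x i :=
  fun r => ⟨max 1 (r i), by positivity, fun M _ τ hτ x hx => ⟨(hx i).trans (le_max_right _ _),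
    fun y hy δ hδ hd => (hd i hi).trans (le_mul_of_one_le_left hδ (le_max_left _ _))⟩⟩

lemma const (c : ℂ) :
    IsTame m fun (M : Type u) [CStarAlgebra M] (_ : ℕ → M) => algebraMap ℂ M c :=
  fun r => ⟨‖c‖, norm_nonneg _, fun M _ τ hτ x hx => ⟨by
    change ‖algebraMap ℂ M c‖ ≤ ‖c‖
    rw [Algebra.algebraMap_eq_smul_one, norm_smul]
    rcases subsingleton_or_nontrivial M with hM | hM
    · simp [Subsingleton.elim (1 : M) 0]
    · simp, fun y hy δ hδ hd => by
        rw [sub_self, hτ.zero]; positivity⟩⟩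

lemma add (hf : IsTame m f) (hg : IsTame m g) : IsTame m fun M _ x => f M x + g M x := fun r => by
  obtain ⟨C, hC, H⟩ := hf r
  obtain ⟨C', hC', H'⟩ := hg r
  refine ⟨C + C', by positivity, fun M _ τ hτ x hx =>
    ⟨(norm_add_le _ _).trans (add_le_add (H M τ hτ x hx).1 (H' M τ hτ x hx).1),
      fun y hy δ hδ hd => ?_⟩⟩
  have h1 := (H M τ hτ x hx).2 y hy δ hδ hd
  have h2 := (H' M τ hτ x hx).2 y hy δ hδ hd
  have h3 := hτ.add_le (f M x - f M y) (g M x - g M y)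
  rw [add_sub_add_comm]
  linarith

lemma mul (hf : IsTame m f) (hg : IsTame m g) : IsTame m fun M _ x => f M x * g M x := fun r => by
  obtain ⟨C, hC, H⟩ := hf r
  obtain ⟨C', hC', H'⟩ := hg r
  refine ⟨2 * (C * C'), by positivity, fun M _ τ hτ x hx =>
    ⟨(norm_mul_le _ _).trans ?_, fun y hy δ hδ hd => ?_⟩⟩
  · have := mul_le_mul (H M τ hτ x hx).1 (H' M τ hτ x hx).1 (norm_nonneg _) hC
    nlinarith [mul_nonneg hC hC']
  · have h1 := (H M τ hτ x hx).2 y hy δ hδ hd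
    have h2 := (H' M τ hτ x hx).2 y hy δ hδ hd
    have h3 := hτ.add_le (f M x * (g M x - g M y)) ((f M x - f M y) * g M y)
    have h4 := (hτ.mul_le (f M x) (g M x - g M y)).trans
      (mul_le_mul (H M τ hτ x hx).1 h2 (traceNorm2_nonneg _ _) hC)
    have h5 := (hτ.mul_le' (f M x - f M y) (g M y)).trans
      (mul_le_mul h1 (H' M τ hτ y hy).1 (norm_nonneg _) (by positivity))
    rw [show f M x * g M x - f M y * g M y =
      f M x * (g M x - g M y) + (f M x - f M y) * g M y by noncomm_ring]
    linarith

lemma adj (hf : IsTame m f) : IsTame m fun M _ x => star (f M x) := fun r => by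
  obtain ⟨C, hC, H⟩ := hf r
  refine ⟨C, hC, fun M _ τ hτ x hx => ⟨by rw [norm_star]; exact (H M τ hτ x hx).1,
    fun y hy δ hδ hd => ?_⟩⟩
  rw [← star_sub]
  exact (hτ.star_le _).trans ((H M τ hτ x hx).2 y hy δ hδ hd)

lemma freeAlgebra_lift {d : ℕ} (p : FreeAlgebra ℂ (Fin d))
    {f : Fin d → ∀ (M : Type u) [CStarAlgebra M], (ℕ → M) → M} (hf : ∀ k, IsTame m (f k)) :
    IsTame m fun M _ x => FreeAlgebra.lift ℂ (fun k => f k M x) p := by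
  induction p using FreeAlgebra.induction with
  | grade0 c => simpa using const c
  | grade1 k => simpa using hf k
  | mul a b ha hb => simpa using ha.mul hb
  | add a b ha hb => simpa using ha.add hb

end IsTame

lemma TrTerm.isTame (t : TrTerm) :
    IsTame t.width fun (M : Type u) [CStarAlgebra M] (x : ℕ → M) => t.eval x := by
  induction t with
  | var i => exact IsTame.var (Nat.lt_succ_self i)
  | zero => simpa [TrTerm.eval] using IsTame.const 0
  | one => simpa [TrTerm.eval] using IsTame.const 1
  | add s t hs ht => exact (hs.mono (le_max_left _ _)).add (ht.mono (le_max_right _ _))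
  | mul s t hs ht => exact (hs.mono (le_max_left _ _)).mul (ht.mono (le_max_right _ _))
  | adj t ht => exact ht.adj
  | smul c t ht =>
    have := (IsTame.const (m := t.width) c).mul ht
    simp only [Algebra.algebraMap_eq_smul_one, smul_mul_assoc, one_mul] at this
    exact this
  | poly p t ht =>
    exact IsTame.freeAlgebra_lift p fun k =>
      (ht k).mono (Finset.le_sup (f := fun k => (t k).width) (Finset.mem_univ k))

lemma abs_ciSup_le {ι : Type*} [Nonempty ι] {f : ι → ℝ} {C : ℝ} (h : ∀ z, |f z| ≤ C) :
    |⨆ z, f z| ≤ C := by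
  have hb : BddAbove (Set.range f) := ⟨C, by rintro _ ⟨z, rfl⟩; exact (abs_le.1 (h z)).2⟩
  obtain ⟨z₀⟩ := ‹Nonempty ι›
  exact abs_le.2 ⟨(abs_le.1 (h z₀)).1.trans (le_ciSup hb z₀), ciSup_le fun z => (abs_le.1 (h z)).2⟩

lemma abs_ciSup_sub_le {ι : Type*} [Nonempty ι] {f g : ι → ℝ} {C ε : ℝ} (hf : ∀ z, |f z| ≤ C)
    (hg : ∀ z, |g z| ≤ C) (h : ∀ z, |f z - g z| ≤ ε) : |(⨆ z, f z) - ⨆ z, g z| ≤ ε := by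
  have hb : ∀ {f : ι → ℝ}, (∀ z, |f z| ≤ C) → BddAbove (Set.range f) := fun h =>
    ⟨C, by rintro _ ⟨z, rfl⟩; exact (abs_le.1 (h z)).2⟩
  rw [abs_sub_le_iff, sub_le_iff_le_add, sub_le_iff_le_add]
  exact ⟨ciSup_le fun z => by linarith [le_ciSup (hb hg) z, (abs_sub_le_iff.1 (h z)).1],
    ciSup_le fun z => by linarith [le_ciSup (hb hf) z, (abs_sub_le_iff.1 (h z)).2]⟩

lemma abs_ciInf_le {ι : Type*} [Nonempty ι] {f : ι → ℝ} {C : ℝ} (h : ∀ z, |f z| ≤ C) :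
    |⨅ z, f z| ≤ C := by
  have hb : BddBelow (Set.range f) := ⟨-C, by rintro _ ⟨z, rfl⟩; exact (abs_le.1 (h z)).1⟩
  obtain ⟨z₀⟩ := ‹Nonempty ι›
  exact abs_le.2 ⟨le_ciInf fun z => (abs_le.1 (h z)).1, (ciInf_le hb z₀).trans (abs_le.1 (h z₀)).2⟩

lemma abs_ciInf_sub_le {ι : Type*} [Nonempty ι] {f g : ι → ℝ} {C ε : ℝ} (hf : ∀ z, |f z| ≤ C)
    (hg : ∀ z, |g z| ≤ C) (h : ∀ z, |f z - g z| ≤ ε) : |(⨅ z, f z) - ⨅ z, g z| ≤ ε := by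
  have hb : ∀ {f : ι → ℝ}, (∀ z, |f z| ≤ C) → BddBelow (Set.range f) := fun h =>
    ⟨-C, by rintro _ ⟨z, rfl⟩; exact (abs_le.1 (h z)).1⟩
  rw [abs_sub_le_iff, sub_le_comm, sub_le_comm (a := ⨅ z, g z)]
  exact ⟨le_ciInf fun z => by linarith [ciInf_le (hb hf) z, (abs_sub_le_iff.1 (h z)).1],
    le_ciInf fun z => by linarith [ciInf_le (hb hg) z, (abs_sub_le_iff.1 (h z)).2]⟩

/-- On bounded sets, a formula is bounded and uniformly continuous for `‖·‖₂`, uniformly in the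
algebra. -/
lemma TrFormula.bounded_and_uniform (φ : TrFormula) : ∀ r : ℕ → ℝ,
    (∃ C : ℝ, ∀ (M : Type u) [CStarAlgebra M] (τ : M → ℂ), IsTraceLike τ →
      ∀ x : ℕ → M, (∀ j, ‖x j‖ ≤ r j) → |φ.eval τ x| ≤ C) ∧
    ∀ ε : ℝ, 0 < ε → ∃ δ : ℝ, 0 < δ ∧ ∀ (M : Type u) [CStarAlgebra M] (τ : M → ℂ), IsTraceLike τ →
      ∀ x y : ℕ → M, (∀ j, ‖x j‖ ≤ r j) → (∀ j, ‖y j‖ ≤ r j) →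
        (∀ i < φ.width, traceNorm2 τ (x i - y i) ≤ δ) → |φ.eval τ x - φ.eval τ y| ≤ ε := by
  have basic : ∀ (t : TrTerm) (R : ℂ → ℝ) (hR : ∀ z w, |R z - R w| ≤ ‖z - w‖) (hR0 : R 0 = 0)
      (r : ℕ → ℝ),
      (∃ C : ℝ, ∀ (M : Type u) [CStarAlgebra M] (τ : M → ℂ), IsTraceLike τ →
        ∀ x : ℕ → M, (∀ j, ‖x j‖ ≤ r j) → |R (τ (t.eval x))| ≤ C) ∧
      ∀ ε : ℝ, 0 < ε → ∃ δ : ℝ, 0 < δ ∧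
        ∀ (M : Type u) [CStarAlgebra M] (τ : M → ℂ), IsTraceLike τ →
        ∀ x y : ℕ → M, (∀ j, ‖x j‖ ≤ r j) → (∀ j, ‖y j‖ ≤ r j) →
        (∀ i < t.width, traceNorm2 τ (x i - y i) ≤ δ) →
          |R (τ (t.eval x)) - R (τ (t.eval y))| ≤ ε := by
    intro t R hR hR0 r
    obtain ⟨C, hC, H⟩ := t.isTame r
    refine ⟨⟨C, fun M _ τ hτ x hx => ?_⟩, fun ε hε => ⟨ε / (C + 1), by positivity,
      fun M _ τ hτ x y hx hy hd => ?_⟩⟩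
    · have := hR (τ (t.eval x)) 0
      rw [hR0, sub_zero, sub_zero] at this
      exact this.trans ((hτ.norm_le _).trans ((hτ.le_norm _).trans (H M τ hτ x hx).1))
    · have h1 := (H M τ hτ x hx).2 y hy _ (by positivity) hd
      refine (hR _ _).trans ?_
      rw [← hτ.map_sub]
      refine (hτ.norm_le _).trans (h1.trans ?_)
      rw [mul_div_assoc', div_le_iff₀ (by positivity)]
      nlinarith
  induction φ with
  | reTr t =>
    exact basic t Complex.re (fun z w => by
      rw [← Complex.sub_re]; exact Complex.abs_re_le_norm _) rfl
  | imTr t =>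
    exact basic t Complex.im (fun z w => by
      rw [← Complex.sub_im]; exact Complex.abs_im_le_norm _) rfl
  | dist s t =>
    intro r
    obtain ⟨C, hC, H⟩ := s.isTame r
    obtain ⟨C', hC', H'⟩ := t.isTame r
    refine ⟨⟨C + C', fun M _ τ hτ x hx => ?_⟩, fun ε hε => ⟨ε / (C + C' + 1), by positivity,
      fun M _ τ hτ x y hx hy hd => ?_⟩⟩
    · rw [TrFormula.eval, abs_of_nonneg (traceNorm2_nonneg _ _)]
      exact (hτ.le_norm _).trans ((norm_sub_le _ _).trans
        (add_le_add (H M τ hτ x hx).1 (H' M τ hτ x hx).1))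
    · have h1 := (H M τ hτ x hx).2 y hy _ (by positivity)
        fun i hi => hd i (hi.trans_le (le_max_left _ _))
      have h2 := (H' M τ hτ x hx).2 y hy _ (by positivity)
        fun i hi => hd i (hi.trans_le (le_max_right _ _))
      have h3 : (C + C') * (ε / (C + C' + 1)) ≤ ε := by
        rw [mul_div_assoc', div_le_iff₀ (by positivity)]; nlinarith
      simp only [TrFormula.eval]
      have e1 := hτ.sub_le (s.eval x) (s.eval y) (t.eval x)
      have e2 := hτ.sub_le (s.eval y) (t.eval y) (t.eval x)
      have e3 := hτ.sub_le (s.eval y) (s.eval x) (t.eval y)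
      have e4 := hτ.sub_le (s.eval x) (t.eval x) (t.eval y)
      rw [hτ.sub_comm (t.eval y)] at e2
      rw [hτ.sub_comm (s.eval y) (s.eval x)] at e3
      rw [abs_sub_le_iff]
      constructor <;> linarith
  | @conn n F φ ih =>
    intro r
    choose C hC using fun k => (ih k r).1
    -- A connective is only continuous; it is uniformly continuous on the compact box of possible
    -- values. This is why boundedness is carried through the same induction.
    let K : Set (Fin n → ℝ) := Set.pi Set.univ fun k => Set.Icc (-C k) (C k)
    have hK : IsCompact K := isCompact_univ_pi fun k => isCompact_Icc
    have hmem : ∀ (M : Type u) [CStarAlgebra M] (τ : M → ℂ), IsTraceLike τ →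
        ∀ x : ℕ → M, (∀ j, ‖x j‖ ≤ r j) → (fun k => (φ k).eval τ x) ∈ K :=
      fun M _ τ hτ x hx k _ => abs_le.1 (hC k M τ hτ x hx)
    refine ⟨?_, fun ε hε => ?_⟩
    · obtain ⟨B, hB⟩ := hK.exists_bound_of_continuousOn F.continuous.continuousOn
      exact ⟨B, fun M _ τ hτ x hx => hB _ (hmem M τ hτ x hx)⟩
    · have hu := hK.uniformContinuousOn_of_continuous F.continuous.continuousOn
      obtain ⟨η, hη, hF⟩ := Metric.uniformContinuousOn_iff.1 hu ε hε
      choose δ hδ hd using fun k => (ih k r).2 (η / 2) (by positivity)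
      obtain ⟨δ', hδ', hle⟩ : ∃ δ' : ℝ, 0 < δ' ∧ ∀ k, δ' ≤ δ k := by
        have h : ∀ᶠ d in 𝓝[>] (0 : ℝ), ∀ k, d ≤ δ k := Filter.eventually_all.2 fun k =>
          Filter.mem_of_superset (Ioo_mem_nhdsGT (hδ k)) fun d hd => hd.2.le
        obtain ⟨d, hd, h0⟩ := (h.and self_mem_nhdsWithin).exists
        exact ⟨d, h0, hd⟩
      refine ⟨δ', hδ', fun M _ τ hτ x y hx hy hxy => ?_⟩
      have := hF _ (hmem M τ hτ x hx) _ (hmem M τ hτ y hy) <| by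
        refine ((dist_pi_le_iff (by positivity : 0 ≤ η / 2)).2 fun k => ?_).trans_lt
          (half_lt_self hη)
        exact hd k M τ hτ x y hx hy fun i hi => (hxy i (hi.trans_le
          (Finset.le_sup (f := fun k => (φ k).width) (Finset.mem_univ k)))).trans (hle k)
      rw [Real.dist_eq] at this
      exact this.le
  | sup r₀ hr i φ ih =>
    intro r
    -- The quantified variable ranges over `D_{r₀}` whatever its free bound was, and takes the same
    -- value on both sides of the comparison.
    obtain ⟨⟨C, hC⟩, hu⟩ := ih (Function.update r i r₀)
    have hdom : ∀ (M : Type u) [CStarAlgebra M] (x : ℕ → M), (∀ j, ‖x j‖ ≤ r j) →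
        ∀ z : {z : M // ‖z‖ ≤ r₀}, ∀ j, ‖Function.update x i z j‖ ≤ Function.update r i r₀ j := by
      intro M _ x hx z j
      by_cases hj : j = i
      · subst hj; simpa using z.2
      · simpa [hj] using hx j
    have hne : ∀ (M : Type u) [CStarAlgebra M], Nonempty {z : M // ‖z‖ ≤ r₀} :=
      fun M _ => ⟨0, by simpa using hr.le⟩
    refine ⟨⟨C, fun M _ τ hτ x hx => ?_⟩, fun ε hε => ?_⟩
    · have := hne M
      simp only [TrFormula.eval]
      exact abs_ciSup_le fun z => (hC M τ hτ _ (hdom M x hx z))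
    · obtain ⟨δ, hδ, hd⟩ := hu ε hε
      refine ⟨δ, hδ, fun M _ τ hτ x y hx hy hxy => ?_⟩
      have := hne M
      simp only [TrFormula.eval]
      refine abs_ciSup_sub_le (fun z => (hC M τ hτ _ (hdom M x hx z)))
        (fun z => (hC M τ hτ _ (hdom M y hy z))) fun z => ?_
      refine hd M τ hτ _ _ (hdom M x hx z) (hdom M y hy z) fun j hj => ?_
      by_cases hji : j = i
      · subst hji; simpa [hτ.zero] using hδ.le
      · simpa [hji] using hxy j (hj.trans_le (le_max_right _ _))
  | inf r₀ hr i φ ih =>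
    intro r
    obtain ⟨⟨C, hC⟩, hu⟩ := ih (Function.update r i r₀)
    have hdom : ∀ (M : Type u) [CStarAlgebra M] (x : ℕ → M), (∀ j, ‖x j‖ ≤ r j) →
        ∀ z : {z : M // ‖z‖ ≤ r₀}, ∀ j, ‖Function.update x i z j‖ ≤ Function.update r i r₀ j := by
      intro M _ x hx z j
      by_cases hj : j = i
      · subst hj; simpa using z.2
      · simpa [hj] using hx j
    have hne : ∀ (M : Type u) [CStarAlgebra M], Nonempty {z : M // ‖z‖ ≤ r₀} :=
      fun M _ => ⟨0, by simpa using hr.le⟩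
    refine ⟨⟨C, fun M _ τ hτ x hx => ?_⟩, fun ε hε => ?_⟩
    · have := hne M
      simp only [TrFormula.eval]
      exact abs_ciInf_le fun z => (hC M τ hτ _ (hdom M x hx z))
    · obtain ⟨δ, hδ, hd⟩ := hu ε hε
      refine ⟨δ, hδ, fun M _ τ hτ x y hx hy hxy => ?_⟩
      have := hne M
      simp only [TrFormula.eval]
      refine abs_ciInf_sub_le (fun z => (hC M τ hτ _ (hdom M x hx z)))
        (fun z => (hC M τ hτ _ (hdom M y hy z))) fun z => ?_
      refine hd M τ hτ _ _ (hdom M x hx z) (hdom M y hy z) fun j hj => ?_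
      by_cases hji : j = i
      · subst hji; simpa [hτ.zero] using hδ.le
      · simpa [hji] using hxy j (hj.trans_le (le_max_right _ _))

/-- The value of a formula depends on the variables below its width only. -/
lemma TrFormula.eval_congr {M : Type u} [CStarAlgebra M] {τ : M → ℂ} (h : IsTraceLike τ)
    (φ : TrFormula) {x y : ℕ → M} (hxy : ∀ i < φ.width, x i = y i) : φ.eval τ x = φ.eval τ y := by
  refine eq_of_forall_dist_le fun ε hε => ?_
  obtain ⟨δ, hδ, hd⟩ := (φ.bounded_and_uniform.{u} fun j => max ‖x j‖ ‖y j‖).2 ε hε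
  exact hd M τ h x y (fun j => le_max_left _ _) (fun j => le_max_right _ _) fun i hi => by
    rw [hxy i hi, sub_self, h.zero]; exact hδ.le

/-! ### Strict inequalities between formulas and constants -/

namespace TrFormula

/-- `φ + c`. -/
def addConst (c : ℝ) (φ : TrFormula) : TrFormula :=
  .conn ⟨fun x : Fin 1 → ℝ => x 0 + c, by fun_prop⟩ fun _ => φ

/-- `-φ`. -/
def neg (φ : TrFormula) : TrFormula :=
  .conn ⟨fun x : Fin 1 → ℝ => -x 0, by fun_prop⟩ fun _ => φ

/-- `|φ|`. -/
def abs (φ : TrFormula) : TrFormula :=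
  .conn ⟨fun x : Fin 1 → ℝ => |x 0|, by fun_prop⟩ fun _ => φ

/-- The maximum of `-1` and of the formulas of a list. -/
def conj : List TrFormula → TrFormula
  | [] => .conn ⟨fun _ : Fin 0 → ℝ => -1, by fun_prop⟩ Fin.elim0
  | φ :: l => .conn ⟨fun x : Fin 2 → ℝ => max (x 0) (x 1), by fun_prop⟩ ![φ, conj l]

/-- The infimum of a formula over the variables of a list, the `i`-th of them over `D_{r i}`. -/
def infs (r : Radii) : List ℕ → TrFormula → TrFormula
  | [], φ => φ
  | i :: l, φ => .inf (r.1 i) (r.2 i) i (infs r l φ)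

variable {M : Type u} [CStarAlgebra M] {τ : M → ℂ}

@[simp] lemma eval_addConst (c : ℝ) (φ : TrFormula) (x : ℕ → M) :
    (φ.addConst c).eval τ x = φ.eval τ x + c := rfl

@[simp] lemma eval_neg (φ : TrFormula) (x : ℕ → M) : φ.neg.eval τ x = -φ.eval τ x := rfl

@[simp] lemma eval_abs (φ : TrFormula) (x : ℕ → M) : φ.abs.eval τ x = |φ.eval τ x| := rfl

lemma eval_conj_lt {l : List TrFormula} {x : ℕ → M} {c : ℝ} (hc : -1 < c) :
    (conj l).eval τ x < c ↔ ∀ φ ∈ l, φ.eval τ x < c := by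
  induction l with
  | nil => simpa [conj, eval] using hc
  | cons φ l ih => simp [conj, eval, ← ih]

lemma eval_infs_lt (h : IsTraceLike τ) (r : Radii) (l : List ℕ) (φ : TrFormula) {c : ℝ} :
    ∀ x : ℕ → M, (infs r l φ).eval τ x < c ↔ ∃ y : ℕ → M, (∀ j, j ∉ l → y j = x j) ∧
      (∀ j ∈ l, ‖y j‖ ≤ r.1 j) ∧ φ.eval τ y < c := by
  induction l with
  | nil =>
    intro x
    simp only [infs, List.not_mem_nil, not_false_eq_true, forall_const, false_imp_iff, true_and]
    exact ⟨fun hx => ⟨x, fun _ => rfl, hx⟩, fun ⟨y, hy, hx⟩ => by rwa [← funext hy]⟩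
  | cons i l ih =>
    intro x
    have : Nonempty {z : M // ‖z‖ ≤ r.1 i} := ⟨0, by simpa using (r.2 i).le⟩
    -- A real infimum has its meaning only for families bounded below, which `bounded_and_uniform`
    -- supplies.
    have hbdd : BddBelow (Set.range fun z : {z : M // ‖z‖ ≤ r.1 i} =>
        (infs r l φ).eval τ (Function.update x i z)) := by
      obtain ⟨C, hC⟩ := ((infs r l φ).bounded_and_uniform.{u} fun j => max ‖x j‖ (r.1 i)).1
      refine ⟨-C, ?_⟩
      rintro _ ⟨z, rfl⟩
      refine (abs_le.1 (hC M τ h _ fun j => ?_)).1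
      by_cases hj : j = i
      · subst hj; simpa using Or.inr z.2
      · simp [hj]
    rw [infs, eval, ciInf_lt_iff hbdd]
    simp only [ih, Subtype.exists, exists_prop]
    constructor
    · rintro ⟨z, hz, y, hy, hyr, hlt⟩
      refine ⟨y, fun j hj => ?_, fun j hj => ?_, hlt⟩
      · rw [List.mem_cons, not_or] at hj
        rw [hy j hj.2, Function.update_of_ne hj.1]
      · by_cases hjl : j ∈ l
        · exact hyr j hjl
        · obtain rfl : j = i := by simpa [hjl] using hj
          rw [hy _ hjl]; simpa using hz
    · rintro ⟨y, hy, hyr, hlt⟩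
      refine ⟨y i, hyr i (by simp), y, fun j hj => ?_, fun j hj => hyr j (by simp [hj]), hlt⟩
      by_cases hji : j = i
      · subst hji; simp
      · rw [Function.update_of_ne hji, hy j (by simp [hji, hj])]

end TrFormula

/-! ### Types of matrix tuples and open sets of types -/

lemma exists_typeSpace_eq_formulaType_matTr (n : ℕ) [NeZero n] (s : Radii)
    {Z : ℕ → Matrix (Fin n) (Fin n) ℂ} (hZ : InDomain s Z) :
    ∃ μ ∈ TypeSpace.bounded.{u} s, μ.1 = formulaType (matTr n) Z := by
  obtain ⟨_, _, _, τ, h, hτ⟩ := exists_normalizedTrace (ULift.{u} (Fin n))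
  let e : Matrix (Fin n) (Fin n) ℂ ≃⋆ₐ[ℂ] Matrix (ULift.{u} (Fin n)) (ULift.{u} (Fin n)) ℂ :=
    StarAlgEquiv.ofAlgEquiv (Matrix.reindexAlgEquiv ℂ ℂ Equiv.ulift.symm) fun A => by
      ext i j; simp [Matrix.star_apply]
  have he : ∀ A, τ (e A) = matTr n A := fun A => by
    rw [h, matTr, Fintype.card_ulift, Fintype.card_fin]
    congr 1
    exact (Equiv.ulift (α := Fin n)).sum_comp fun i => A i i
  have hev : formulaType τ (fun i => e (Z i)) = formulaType (matTr n) Z :=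
    funext fun φ => φ.eval_map e he Z
  refine ⟨typeOf hτ fun i => e (Z i), ⟨_, _, _, ‹_›, ‹_›, τ, fun i => e (Z i), hτ, fun j => ?_, rfl⟩,
    hev⟩
  rw [StarAlgEquiv.norm_map]
  exact hZ j

lemma isOpen_setOf_formula_lt (φ : TrFormula) (c : ℝ) : IsOpen {μ : TypeSpace.{u} | μ.1 φ < c} := by
  refine isOpen_iSup_iff.2 fun r => isOpen_coinduced.2 ?_
  refine isOpen_induced_iff.2 ⟨{f : TrFormula → ℝ | f φ < c}, ?_, rfl⟩
  exact isOpen_lt (continuous_apply φ) continuous_const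

/-- The sets `{μ | μ φ < 0}` form a basis of neighborhoods of a point within a bounded part of the
type space. -/
lemma exists_formula_of_isOpen {O : Set TypeSpace.{u}} (hO : IsOpen O) (s : Radii)
    {μ : TypeSpace.{u}} (hμ : μ ∈ O) (hs : μ ∈ TypeSpace.bounded s) :
    ∃ φ : TrFormula, μ.1 φ < 0 ∧ ∀ ν ∈ TypeSpace.bounded s, ν.1 φ < 0 → ν ∈ O := by
  classical
  have h1 := isOpen_coinduced.1 (isOpen_iSup_iff.1 hO s)
  obtain ⟨V, hV, hVO⟩ := isOpen_induced_iff.1 h1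
  have hmem : ∀ ν (hν : ν ∈ TypeSpace.bounded s), ν.1 ∈ V ↔ ν ∈ O := fun ν hν =>
    Set.ext_iff.1 hVO ⟨ν, hν⟩
  -- A basic open set constrains finitely many formulas, each to an interval; the conditions `|ν φ -
  -- μ φ| < δ φ` merge into one maximum. The floor `-1` in `conj` makes it negative even when `I` is
  -- empty.
  obtain ⟨I, W, hW, hWV⟩ := isOpen_pi_iff.1 hV μ.1 ((hmem μ hs).2 hμ)
  have hδ : ∀ φ ∈ I, ∃ δ > 0, Metric.ball (μ.1 φ) δ ⊆ W φ := fun φ hφ =>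
    Metric.isOpen_iff.1 (hW φ hφ).1 _ (hW φ hφ).2
  choose! δ hδ0 hδ using hδ
  let l : List TrFormula := I.toList.map fun φ => ((φ.addConst (-(μ.1 φ))).abs).addConst (-δ φ)
  have key : ∀ ν : TypeSpace.{u}, ν.1 (TrFormula.conj l) < 0 ↔ ∀ φ ∈ I, |ν.1 φ - μ.1 φ| < δ φ := by
    rintro ⟨_, N, _, _, _, _, τ, X, hτ, rfl⟩
    simp only [formulaType]
    rw [TrFormula.eval_conj_lt (by norm_num)]
    simp only [l, List.mem_map, Finset.mem_toList, forall_exists_index, and_imp,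
      forall_apply_eq_imp_iff₂, TrFormula.eval_addConst, TrFormula.eval_abs]
    refine forall₂_congr fun φ _ => ?_
    rw [← sub_eq_add_neg, ← sub_eq_add_neg, sub_neg]
  refine ⟨TrFormula.conj l, (key μ).2 fun φ hφ => by simpa using hδ0 φ hφ, fun ν hν h => ?_⟩
  refine (hmem ν hν).1 (hWV fun φ hφ => hδ φ hφ ?_)
  exact (key ν).1 h φ hφ

lemma traceNorm2_map {M : Type u} {M' : Type v} [CStarAlgebra M] [CStarAlgebra M']
    {τ : M → ℂ} {τ' : M' → ℂ} (e : M ≃⋆ₐ[ℂ] M') (he : ∀ x, τ' (e x) = τ x) (x : M) :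
    traceNorm2 τ' (e x) = traceNorm2 τ x := by
  rw [traceNorm2, ← map_star, ← map_mul, he, traceNorm2]

/-! ### Limits along ultrafilters and logarithms -/

/-- By compactness of `EReal` both limits exist, and addition is continuous at `(0, x)` even for
infinite `x`. -/
lemma Ultrafilter.lim_map_le_lim_map {U : Ultrafilter ℕ} {f g a : ℕ → EReal}
    (h : ∀ᶠ n in U, f n ≤ a n + g n) (ha : Filter.Tendsto a U (𝓝 0)) :
    (U.map f).lim ≤ (U.map g).lim := by
  have hf : Filter.Tendsto f U (𝓝 (U.map f).lim) := (U.map f).le_nhds_lim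
  have hg : Filter.Tendsto g U (𝓝 (U.map g).lim) := (U.map g).le_nhds_lim
  have hs : Filter.Tendsto (fun n => a n + g n) U (𝓝 (0 + (U.map g).lim)) :=
    (EReal.continuousAt_add (p := (0, (U.map g).lim)) (by simp) (by simp)).tendsto.comp
      (ha.prodMk_nhds hg)
  rw [zero_add] at hs
  exact le_of_tendsto_of_tendsto hf hs h

lemma Ultrafilter.eventually_ne_of_ne_pure {U : Ultrafilter ℕ} (hU : ∀ n : ℕ, U ≠ pure n) :
    ∀ᶠ n in U, n ≠ 0 := by
  by_contra h
  rw [← Ultrafilter.eventually_not] at h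
  refine hU 0 (Ultrafilter.eq_of_le ?_)
  rw [Ultrafilter.coe_pure, Filter.le_pure_iff]
  simpa [Filter.Eventually, Set.ofPred_eq_eq_singleton] using h

lemma Ultrafilter.le_atTop_of_ne_pure {U : Ultrafilter ℕ} (hU : ∀ n : ℕ, U ≠ pure n) :
    (U : Filter ℕ) ≤ Filter.atTop := by
  rw [← Nat.cofinite_eq_atTop]
  refine (U.le_cofinite_or_eq_pure).resolve_right ?_
  rintro ⟨n, hn⟩
  exact hU n hn

/-- A factor independent of `n` costs `log C / n²`, which tends to zero along `U`. In the proof `C +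
1` replaces `C` to keep the logarithm finite when `C = 0`. -/
lemma lim_log_le_of_le_mul {U : Ultrafilter ℕ} (hU : ∀ n : ℕ, U ≠ pure n) {K L : ℕ → ℕ∞} (C : ℕ)
    (h : ∀ n, n ≠ 0 → K n ≤ C * L n) :
    (U.map fun n : ℕ => ((1 / (n : ℝ) ^ 2 : ℝ) : EReal) * ENNReal.log (K n : ENNReal)).lim ≤
      (U.map fun n : ℕ => ((1 / (n : ℝ) ^ 2 : ℝ) : EReal) * ENNReal.log (L n : ENNReal)).lim := by
  refine Ultrafilter.lim_map_le_lim_map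
    (a := fun n => ((1 / (n : ℝ) ^ 2 * Real.log (C + 1) : ℝ) : EReal)) ?_ ?_
  · filter_upwards [Ultrafilter.eventually_ne_of_ne_pure hU] with n hn
    have hlog : ENNReal.log (K n : ENNReal) ≤ (Real.log (C + 1) : ℝ) + ENNReal.log (L n) := by
      have hC : ENNReal.log ((C + 1 : ℕ) : ENNReal) = (Real.log (C + 1) : ℝ) := by
        rw [ENNReal.log_pos_real (by simp) (by simp)]; norm_cast
      rw [← hC, ← ENNReal.log_mul_add]
      refine ENNReal.log_le_log ?_
      have h2 : K n ≤ ((C + 1 : ℕ) : ℕ∞) * L n := (h n hn).trans (by gcongr; simp)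
      exact_mod_cast h2
    refine (mul_le_mul_of_nonneg_left hlog (by positivity)).trans ?_
    rw [EReal.left_distrib_of_nonneg_of_ne_top (by positivity) (EReal.coe_ne_top _), EReal.coe_mul]
  · rw [← EReal.coe_zero]
    refine (continuous_coe_real_ereal.tendsto 0).comp ?_
    have : Filter.Tendsto (fun n : ℕ => 1 / (n : ℝ) ^ 2 * Real.log (C + 1)) Filter.atTop (𝓝 0) := by
      simpa using ((tendsto_const_div_pow (1 : ℝ) 2 (two_ne_zero)).comp
        tendsto_natCast_atTop_atTop).mul_const (Real.log (C + 1))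
    exact this.mono_left (Ultrafilter.le_atTop_of_ne_pure hU)

lemma entAt_le_of_forall {U : Ultrafilter ℕ} (hU : ∀ n : ℕ, U ≠ pure n) {r s : Radii}
    {F G : Finset ℕ} {ε δ : ℝ} {K L : Set TypeSpace.{u}} (C : ℕ)
    (h : ∀ O : Set TypeSpace.{u}, IsOpen O → L ⊆ O → ∃ O' : Set TypeSpace.{u}, IsOpen O' ∧ K ⊆ O' ∧
      ∀ n, n ≠ 0 → orbCoveringNumber F ε (microstates n r O') ≤
        C * orbCoveringNumber G δ (microstates n s O)) :
    entAt U r F ε K ≤ entAt U s G δ L := by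
  refine le_iInf₂ fun O hO => le_iInf fun hLO => ?_
  obtain ⟨O', hO', hKO', hle⟩ := h O hO hLO
  exact (iInf₂_le_of_le O' hO' (iInf_le _ hKO')).trans (lim_log_le_of_le_mul hU C hle)

lemma entAt_eq_bot {U : Ultrafilter ℕ} (hU : ∀ n : ℕ, U ≠ pure n) {r : Radii} {F : Finset ℕ} {ε : ℝ}
    {K O : Set TypeSpace.{u}} (hO : IsOpen O) (hKO : K ⊆ O)
    (h : ∀ n, n ≠ 0 → microstates n r O = ∅) : entAt U r F ε K = ⊥ := by
  refine le_bot_iff.1 ((iInf₂_le_of_le O hO (iInf_le _ hKO)).trans ?_)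
  have hz : ∀ᶠ n : ℕ in U, ((1 / ((n : ℕ) : ℝ) ^ 2 : ℝ) : EReal) *
      ENNReal.log (orbCoveringNumber F ε (microstates n r O) : ENNReal) ≤ 0 + ⊥ := by
    filter_upwards [Ultrafilter.eventually_ne_of_ne_pure hU] with n hn
    have : orbCoveringNumber F ε (microstates n r O) = 0 := by
      refine le_antisymm (iInf₂_le_of_le ∅ ?_ ?_) zero_le
      · rw [h n hn]; exact Set.empty_subset _
      · simp
    rw [this]
    simp only [ENat.toENNReal_zero, ENNReal.log_zero]
    rw [EReal.coe_mul_bot_of_pos (by positivity)]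
    simp
  refine (Ultrafilter.lim_map_le_lim_map (a := fun _ => 0) (g := fun _ => ⊥) hz
    tendsto_const_nhds).trans ?_
  exact le_of_eq (tendsto_nhds_unique (Ultrafilter.le_nhds_lim _) tendsto_const_nhds)

/-! ### The operator norm expressed through the 2-norm -/

/-- A formula that is negative iff the operator norm of `x_j` is greater than `r`. -/
def TrFormula.normGt (r : ℝ) (j : ℕ) : TrFormula :=
  .infs ⟨fun _ => 1, fun _ => one_pos⟩ [j + 1]
    (.conn ⟨fun x : Fin 2 → ℝ => x 0 - x 1, by fun_prop⟩
      ![.dist (.smul r (.var (j + 1))) .zero, .dist (.mul (.var j) (.var (j + 1))) .zero])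

lemma TrFormula.eval_normGt_lt {M : Type u} [CStarAlgebra M] {τ : M → ℂ} (h : IsTraceLike τ)
    (r : ℝ) (j : ℕ) (x : ℕ → M) : (TrFormula.normGt r j).eval τ x < 0 ↔ ∃ y : M, ‖y‖ ≤ 1 ∧
      traceNorm2 τ ((r : ℂ) • y) < traceNorm2 τ (x j * y) := by
  rw [TrFormula.normGt, TrFormula.eval_infs_lt h]
  constructor
  · rintro ⟨y, hy, hy1, hlt⟩
    refine ⟨y (j + 1), hy1 _ (by simp), ?_⟩
    have := hy j (by simp)
    simpa [TrFormula.eval, TrTerm.eval, this] using hlt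
  · rintro ⟨y, hy1, hlt⟩
    refine ⟨Function.update x (j + 1) y, fun k hk => ?_, fun k hk => ?_, ?_⟩
    · simp only [List.mem_singleton] at hk
      simp [hk]
    · simp only [List.mem_singleton] at hk
      simpa [hk] using hy1
    · simpa [TrFormula.eval, TrTerm.eval] using hlt

lemma traceNorm2_real_smul {M : Type u} [CStarAlgebra M] {τ : M → ℂ} (h : IsTraceLike τ) {r : ℝ}
    (hr : 0 < r) (x : M) : traceNorm2 τ ((r : ℂ) • x) = r * traceNorm2 τ x := by
  refine le_antisymm (by simpa [abs_of_pos hr] using h.smul_le r x) ?_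
  have h1 := h.smul_le ((r⁻¹ : ℝ) : ℂ) ((r : ℂ) • x)
  rw [smul_smul, ← Complex.ofReal_mul, inv_mul_cancel₀ hr.ne', Complex.ofReal_one, one_smul,
    Complex.norm_real, Real.norm_of_nonneg (by positivity)] at h1
  rwa [← le_inv_mul_iff₀ hr]

lemma gnsStarAlgHom_apply_coe {M : Type u} [CStarAlgebra M] [PartialOrder M]
    [StarOrderedRing M] {τ : M →ₚ[ℂ] ℂ} (a : M) (ξ : τ.PreGNS) :
    τ.gnsStarAlgHom a (ξ : τ.GNS) = (τ.leftMulMapPreGNS a ξ : τ.GNS) :=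
  τ.gnsNonUnitalStarAlgHom_apply_coe

/-- The operator norm is determined by the left multiplication on the 2-norm. -/
lemma norm_le_of_traceNorm2_mul_le {M : Type u} [CStarAlgebra M] [PartialOrder M]
    [StarOrderedRing M] {τ : M →ₚ[ℂ] ℂ} (hτ : IsFaithfulNormalTracialState τ) {x : M} {r : ℝ}
    (hr : 0 < r)
    (h : ∀ y : M, ‖y‖ ≤ 1 → traceNorm2 τ (x * y) ≤ r * traceNorm2 τ y) : ‖x‖ ≤ r := by
  have hall : ∀ y : M, traceNorm2 τ (x * y) ≤ r * traceNorm2 τ y := by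
    intro y
    have hc : (0 : ℝ) < (‖y‖ + 1)⁻¹ := by positivity
    have h1 := h (((‖y‖ + 1)⁻¹ : ℝ) • y) <| by
      rw [norm_smul, Real.norm_of_nonneg hc.le, inv_mul_le_iff₀ (by positivity)]
      linarith
    rw [← Complex.coe_smul, mul_smul_comm, traceNorm2_real_smul hτ.isTraceLike hc,
      traceNorm2_real_smul hτ.isTraceLike hc] at h1
    rw [mul_left_comm] at h1
    exact le_of_mul_le_mul_left h1 hc
  -- Faithfulness of `τ` makes the GNS representation injective, hence isometric, so it suffices to
  -- bound the operator on the dense image of `M`.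
  have hinj : Function.Injective τ.gnsStarAlgHom := by
    rw [injective_iff_map_eq_zero]
    intro a ha
    have h1 : τ.gnsStarAlgHom a (τ.toPreGNS 1 : τ.GNS) = 0 := by rw [ha]; rfl
    rw [gnsStarAlgHom_apply_coe] at h1
    refine hτ.isTraceLike.eq_zero a ?_
    have h2 := congrArg norm h1
    rw [UniformSpace.Completion.norm_coe, norm_zero] at h2
    rw [traceNorm2_eq_norm, ← h2]
    simp
  rw [← NonUnitalStarAlgHom.norm_map τ.gnsStarAlgHom hinj x]
  refine ContinuousLinearMap.opNorm_le_bound _ hr.le fun ξ => ?_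
  induction ξ using UniformSpace.Completion.induction_on with
  | hp => exact isClosed_le (by fun_prop) (by fun_prop)
  | ih ξ =>
    rw [gnsStarAlgHom_apply_coe,
      UniformSpace.Completion.norm_coe, UniformSpace.Completion.norm_coe]
    have h1 := hall (τ.ofPreGNS ξ)
    rw [traceNorm2_eq_norm, traceNorm2_eq_norm] at h1
    exact h1

/-- The entropy at radii `r` of the type of a tuple outside `∏ⱼ D_{rⱼ}` is `-∞`. -/
lemma entAt_typeOf_eq_bot {U : Ultrafilter ℕ} (hU : ∀ n : ℕ, U ≠ pure n) {M : Type u}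
    [CStarAlgebra M] [PartialOrder M] [StarOrderedRing M] [WStarAlgebra M] {τ : M →ₚ[ℂ] ℂ}
    (hτ : IsFaithfulNormalTracialState τ) {X : ℕ → M} {r : Radii} (hX : ¬ InDomain r X)
    (F : Finset ℕ) (ε : ℝ) : entAt U r F ε {typeOf hτ X} = ⊥ := by
  obtain ⟨j, hj⟩ := not_forall.1 hX
  -- Exceeding the radius `r j` is an open condition on types, and no matrix tuple from the domain
  -- satisfies it.
  refine entAt_eq_bot hU (isOpen_setOf_formula_lt (TrFormula.normGt (r.1 j) j) 0) ?_ fun n hn => ?_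
  · rw [Set.singleton_subset_iff]
    refine (TrFormula.eval_normGt_lt hτ.isTraceLike _ _ X).2 ?_
    by_contra hcon
    push Not at hcon
    refine hj (norm_le_of_traceNorm2_mul_le hτ (r.2 j) fun y hy => ?_)
    rw [← traceNorm2_real_smul hτ.isTraceLike (r.2 j)]
    exact hcon y hy
  · have : NeZero n := ⟨hn⟩
    have hn := isTraceLike_matTr n
    refine Set.eq_empty_iff_forall_notMem.2 ?_
    rintro x ⟨hx, μ, hμ, hμx⟩
    rw [Set.mem_ofPred_eq, hμx] at hμ
    obtain ⟨y, -, hlt⟩ := (TrFormula.eval_normGt_lt hn _ _ x).1 hμ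
    rw [traceNorm2_real_smul hn (r.2 j)] at hlt
    refine hlt.not_ge ((hn.mul_le _ _).trans ?_)
    exact mul_le_mul_of_nonneg_right (hx j) (traceNorm2_nonneg _ _)

/-! ### Covering numbers -/

/-- A separated family of maximal size is a net. If fewer than `N` points already suffice, the net
is padded with arbitrary points. -/
lemma exists_net_of_forall_close {α : Type*} [Nonempty α] {S : Set α} {R : α → α → Prop}
    (hR : ∀ x y, R x y → R y x) (N : ℕ)
    (h : ∀ y : Fin (N + 1) → α, (∀ k, y k ∈ S) → ∃ j k, j ≠ k ∧ R (y j) (y k)) :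
    ∃ t : Fin N → α, ∀ z ∈ S, ∃ k, R z (t k) := by
  induction N with
  | zero =>
    refine ⟨Fin.elim0, fun z hz => ?_⟩
    obtain ⟨j, k, hjk, -⟩ := h (fun _ => z) fun _ => hz
    exact absurd (Subsingleton.elim (α := Fin 1) j k) hjk
  | succ N ih =>
    by_cases hN : ∀ y : Fin (N + 1) → α, (∀ k, y k ∈ S) → ∃ j k, j ≠ k ∧ R (y j) (y k)
    · obtain ⟨t, ht⟩ := ih hN
      refine ⟨Fin.cons (Classical.arbitrary α) t, fun z hz => ?_⟩
      obtain ⟨k, hk⟩ := ht z hz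
      exact ⟨k.succ, by simpa using hk⟩
    · push Not at hN
      obtain ⟨t, ht, hsep⟩ := hN
      refine ⟨t, fun z hz => ?_⟩
      obtain ⟨j, k, hjk, hclose⟩ := h (Fin.cons z t : Fin (N + 2) → α) (Fin.cases hz ht)
      induction j using Fin.cases with
      | zero =>
        induction k using Fin.cases with
        | zero => exact absurd rfl hjk
        | succ k => exact ⟨k, by simpa using hclose⟩
      | succ j =>
        induction k using Fin.cases with
        | zero => exact ⟨j, hR _ _ (by simpa using hclose)⟩
        | succ k =>
          exact absurd (by simpa using hclose) (hsep j k fun h => hjk (congrArg _ h))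

lemma matTr_conjStarAlgAut {n : ℕ} (V : unitary (Matrix (Fin n) (Fin n) ℂ))
    (A : Matrix (Fin n) (Fin n) ℂ) :
    matTr n (Unitary.conjStarAlgAut ℂ _ V A) = matTr n A := by
  rw [Unitary.conjStarAlgAut_apply, matTr, Matrix.trace_mul_comm, ← mul_assoc,
    Unitary.coe_star_mul_self, one_mul, matTr]

/-- `ℕ∞` is well ordered, so the infimum is attained once some cover exists, and `Ω` covers itself.
-/
lemma exists_subset_orbNhd_encard_eq {n : ℕ} [NeZero n] (F : Finset ℕ) {ε : ℝ} (hε : 0 < ε)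
    (Ω : Set (ℕ → Matrix (Fin n) (Fin n) ℂ)) :
    ∃ Ω', Ω ⊆ orbNhd F ε Ω' ∧ Ω'.encard = orbCoveringNumber F ε Ω := by
  have hne : Nonempty {Ω' // Ω ⊆ orbNhd F ε Ω'} := ⟨Ω, fun X hX => ⟨1, one_mem _, X, hX,
    fun i _ => by simpa [(isTraceLike_matTr n).zero] using hε⟩⟩
  obtain ⟨Ω', h⟩ := ciInf_mem fun Ω' : {Ω' // Ω ⊆ orbNhd F ε Ω'} => Ω'.1.encard
  exact ⟨Ω'.1, Ω'.2, by rw [orbCoveringNumber, iInf_subtype']; exact h⟩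

lemma consTuple_map {M : Type u} {M' : Type v} (f : M → M') (a : M) (X : ℕ → M) :
    consTuple (f a) (fun j => f (X j)) = fun j => f (consTuple a X j) := by
  ext (_ | j) <;> rfl

/-- The formula `ψ(y, Z)` allows no `N + 1` solutions `y` in `D_R` at mutual distances `≥ ε`. -/
def NoSeparatedSolutions {M : Type u} [CStarAlgebra M] (τ : M → ℂ) (ψ : TrFormula) (N : ℕ)
    (R ε c : ℝ) (Z : ℕ → M) : Prop :=
  ∀ y : Fin (N + 1) → M, (∀ k, ‖y k‖ ≤ R) → (∀ k, ψ.eval τ (consTuple (y k) Z) < c) →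
    ∃ j k, j ≠ k ∧ traceNorm2 τ (y j - y k) < ε

/-- Given `X` with parameters `Z`, conjugate so that `Z` is near a representative `ρ c` of its
covering center. By `hδ`, the conjugated `X i` are near-solutions over `ρ c`, hence close to the
chosen net there. A new center is thus an old center with one net index for each `i ∈ F`. -/
lemma orbCoveringNumber_le_mul {n : ℕ} [NeZero n] {F : Finset ℕ} {N : ℕ → ℕ} {ψ : ℕ → TrFormula}
    {r s : Radii} {ε δ : ℝ} (hδ0 : 0 < δ) {b c : ℕ → ℝ} {l : ℕ}
    {Ω Ω₂ : Set (ℕ → Matrix (Fin n) (Fin n) ℂ)} (hΩ₂ : ∀ Z ∈ Ω₂, InDomain s Z)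
    (hΩ : ∀ X ∈ Ω, InDomain r X ∧ ∃ Z ∈ Ω₂, ∀ i ∈ F,
      (ψ i).eval (matTr n) (consTuple (X i) Z) < b i ∧
        NoSeparatedSolutions (matTr n) (ψ i) (N i) (r.1 i) ε (c i) Z)
    (hδ : ∀ i ∈ F, ∀ (x : Matrix (Fin n) (Fin n) ℂ) (Z W : ℕ → Matrix (Fin n) (Fin n) ℂ),
      ‖x‖ ≤ r.1 i → InDomain s Z → InDomain s W →
      (∀ j < l, traceNorm2 (matTr n) (Z j - W j) ≤ 2 * δ) →
      (ψ i).eval (matTr n) (consTuple x Z) < b i → (ψ i).eval (matTr n) (consTuple x W) < c i) :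
    orbCoveringNumber F ε Ω ≤
      (Fintype.card (∀ i : F, Fin (N i)) : ℕ) * orbCoveringNumber (Finset.range l) δ Ω₂ := by
  classical
  have hn := isTraceLike_matTr n
  obtain ⟨Ω', hcov, hcard⟩ := exists_subset_orbNhd_encard_eq (Finset.range l) hδ0 Ω₂
  -- the good elements of `Ω₂`, and their nets
  let G : (ℕ → Matrix (Fin n) (Fin n) ℂ) → Prop := fun Z => Z ∈ Ω₂ ∧ ∀ i ∈ F,
    NoSeparatedSolutions (matTr n) (ψ i) (N i) (r.1 i) ε (c i) Z
  have hnet : ∀ Z, ∃ t : ∀ i : F, Fin (N i) → Matrix (Fin n) (Fin n) ℂ, G Z → ∀ (i : F) x,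
      ‖x‖ ≤ r.1 i → (ψ i).eval (matTr n) (consTuple x Z) < c i →
        ∃ k, traceNorm2 (matTr n) (x - t i k) < ε := by
    intro Z
    by_cases hZ : G Z
    · have := fun i : F => exists_net_of_forall_close
        (S := {x | ‖x‖ ≤ r.1 i ∧ (ψ i).eval (matTr n) (consTuple x Z) < c i})
        (R := fun x y => traceNorm2 (matTr n) (x - y) < ε)
        (fun x y h => by rwa [hn.sub_comm]) (N i)
        fun y hy => hZ.2 i i.2 y (fun k => (hy k).1) fun k => (hy k).2
      choose t ht using this
      exact ⟨t, fun _ i x hx hxc => ht i x ⟨hx, hxc⟩⟩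
    · exact ⟨fun _ _ => 0, fun h => absurd h hZ⟩
  choose t ht using hnet
  -- each center gets a good element close to its orbit
  have hrep : ∀ c, ∃ Z, (∃ Z', G Z' ∧ Z' ∈ orbNhd (Finset.range l) δ {c}) →
      G Z ∧ Z ∈ orbNhd (Finset.range l) δ {c} := by
    intro c
    by_cases hc : ∃ Z', G Z' ∧ Z' ∈ orbNhd (Finset.range l) δ {c}
    · obtain ⟨Z', h⟩ := hc
      exact ⟨Z', fun _ => h⟩
    · exact ⟨0, fun h => absurd h hc⟩
  choose ρ hρ using hrep
  let f : (∀ i : F, Fin (N i)) × (ℕ → Matrix (Fin n) (Fin n) ℂ) → ℕ → Matrix (Fin n) (Fin n) ℂ :=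
    fun p i => if hi : i ∈ F then t (ρ p.2) ⟨i, hi⟩ (p.1 ⟨i, hi⟩) else 0
  have hle : (f '' (Set.univ ×ˢ Ω')).encard ≤
      (Fintype.card (∀ i : F, Fin (N i)) : ℕ) * orbCoveringNumber (Finset.range l) δ Ω₂ := by
    refine (Set.encard_image_le _ _).trans ?_
    rw [Set.encard_prod, hcard, Set.encard_univ, ENat.card_eq_coe_fintype_card]
  refine (iInf₂_le _ fun X hX => ?_).trans hle
  obtain ⟨hXr, Z, hZ, hZF⟩ := hΩ X hX
  have hGZ : G Z := ⟨hZ, fun i hi => (hZF i hi).2⟩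
  obtain ⟨V, hV, c₀, hc₀, hVc⟩ := hcov hZ
  obtain ⟨hGρ, W, hW, c₁, hc₁, hWc⟩ := hρ c₀ ⟨Z, hGZ, V, hV, c₀, rfl, hVc⟩
  rw [Set.mem_singleton_iff.1 hc₁] at hWc
  let eV := Unitary.conjStarAlgAut ℂ (Matrix (Fin n) (Fin n) ℂ) ⟨V, hV⟩
  let eW := Unitary.conjStarAlgAut ℂ (Matrix (Fin n) (Fin n) ℂ) ⟨W, hW⟩
  -- `W` takes the center near `ρ c₀` and `V` takes it near `Z`, so conjugation by `V W⁻¹` brings `ρ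
  -- c₀` within `2δ` of `Z`.
  let u : unitary (Matrix (Fin n) (Fin n) ℂ) := ⟨V, hV⟩ * ⟨W, hW⟩⁻¹
  let e := Unitary.conjStarAlgAut ℂ (Matrix (Fin n) (Fin n) ℂ) u
  have heW : ∀ x, e (eW x) = eV x := fun x => by
    change (e * eW) x = _
    simp only [e, eW, eV, u, ← map_mul, inv_mul_cancel_right]
  have hetr : ∀ x, matTr n (e x) = matTr n x := matTr_conjStarAlgAut u
  have hclose : ∀ j < l, traceNorm2 (matTr n) (Z j - e (ρ c₀ j)) ≤ 2 * δ := by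
    intro j hj
    have h1 : traceNorm2 (matTr n) (Z j - eV (c₀ j)) < δ := hVc j (Finset.mem_range.2 hj)
    have h2 : traceNorm2 (matTr n) (ρ c₀ j - eW (c₀ j)) < δ := hWc j (Finset.mem_range.2 hj)
    have h3 := hn.sub_le (Z j) (eV (c₀ j)) (e (ρ c₀ j))
    rw [← heW, ← map_sub, traceNorm2_map e hetr, hn.sub_comm, heW] at h3
    rw [hn.sub_comm] at h3
    rw [hn.sub_comm (eW (c₀ j))] at h3
    linarith
  have hk : ∀ i : F, ∃ k, traceNorm2 (matTr n) (e.symm (X i) - t (ρ c₀) i k) < ε := by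
    intro i
    refine ht (ρ c₀) hGρ i _ (by rw [StarAlgEquiv.norm_map]; exact hXr i) ?_
    have h1 := hδ i i.2 (X i) Z (fun j => e (ρ c₀ j)) (hXr i) (hΩ₂ Z hZ)
      (fun j => by rw [StarAlgEquiv.norm_map]; exact hΩ₂ _ hGρ.1 j) hclose (hZF i i.2).1
    rw [← (ψ i).eval_map e hetr, ← consTuple_map, StarAlgEquiv.apply_symm_apply]
    exact h1
  choose k hk using hk
  refine ⟨u, u.2, f (k, c₀), ⟨(k, c₀), ⟨Set.mem_univ _, hc₀⟩, rfl⟩, fun i hi => ?_⟩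
  have h1 := hk ⟨i, hi⟩
  rw [← traceNorm2_map e hetr, map_sub, StarAlgEquiv.apply_symm_apply] at h1
  simpa [f, hi, e] using h1

/-! ### Algebraic elements -/

/-- `a` lies in a compact set the distance to which is given by formulas with the parameters `Z`. -/
def IsAlgebraicVia {M : Type u} [CStarAlgebra M] [PartialOrder M] [StarOrderedRing M]
    (τ : M →ₚ[ℂ] ℂ) (Z : ℕ → M) (a : M) : Prop :=
  ∃ A : Set τ.PreGNS, IsCompact A ∧ τ.toPreGNS a ∈ A ∧ ∀ r : ℝ, 0 < r → ∀ ε : ℝ, 0 < ε →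
    ∃ ψ : TrFormula, ∀ x : M, ‖x‖ ≤ r →
      |Metric.infDist (τ.toPreGNS x) A - ψ.eval τ (consTuple x Z)| < ε

/-- Take `η = ε/16`, with `ψ` approximating the distance to `A` within `η`. A solution of `ψ < 2η`
is within `ε/4` of `A`, hence within `ε/2` of one of the `N` centers of an `ε/4`-net of `A`. By
pigeonhole, two of `N + 1` solutions share a center. -/
lemma IsAlgebraicVia.exists_noSeparatedSolutions {M : Type u} [CStarAlgebra M] [PartialOrder M]
    [StarOrderedRing M] {τ : M →ₚ[ℂ] ℂ} {Z : ℕ → M} {a : M} (h : IsAlgebraicVia τ Z a) {R : ℝ}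
    (hR : 0 < R) (ha : ‖a‖ ≤ R) {ε : ℝ} (hε : 0 < ε) :
    ∃ (ψ : TrFormula) (N : ℕ) (η : ℝ), 0 < η ∧ ψ.eval τ (consTuple a Z) < η ∧
      NoSeparatedSolutions τ ψ N R ε (2 * η) Z := by
  obtain ⟨A, hA, haA, hdef⟩ := h
  obtain ⟨t, ht, hcov⟩ := Metric.totallyBounded_iff.1 hA.totallyBounded (ε / 4) (by positivity)
  obtain ⟨ψ, hψ⟩ := hdef R hR (ε / 16) (by positivity)
  refine ⟨ψ, ht.toFinset.card, ε / 16, by positivity, ?_, fun y hy hlt => ?_⟩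
  · have := hψ a ha
    rw [Metric.infDist_zero_of_mem haA] at this
    linarith [(abs_lt.1 this).1]
  · have hc : ∀ k, ∃ c ∈ ht.toFinset, dist (τ.toPreGNS (y k)) c < ε / 2 := by
      intro k
      have h1 : Metric.infDist (τ.toPreGNS (y k)) A < ε / 4 := by
        linarith [(abs_lt.1 (hψ (y k) (hy k))).2, hlt k]
      obtain ⟨b, hb, hyb⟩ := (Metric.infDist_lt_iff ⟨_, haA⟩).1 h1
      obtain ⟨c, hc, hbc⟩ := Set.mem_iUnion₂.1 (hcov hb)
      refine ⟨c, ht.mem_toFinset.2 hc, (dist_triangle _ b _).trans_lt ?_⟩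
      linarith [Metric.mem_ball.1 hbc]
    choose c hct hc using hc
    obtain ⟨j, -, k, -, hjk, hcjk⟩ := Finset.exists_ne_map_eq_of_card_lt_of_maps_to
      (s := Finset.univ) (t := ht.toFinset) (f := c) (by simp) (fun k _ => hct k)
    refine ⟨j, k, hjk, ?_⟩
    rw [traceNorm2_sub_eq_dist]
    refine (dist_triangle_right _ _ (c j)).trans_lt ?_
    have := hc k
    rw [← hcjk] at this
    linarith [hc j]

/-! ### Formulas expressing separation and extension -/

/-- Layout of the variables: indices below `m` hold the tuple `x`, the odd offsets `m + 2j + 1` hold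
the parameters, and the even offsets `m + 2k` hold the competing solutions. -/
lemma consTuple_injective {m a : ℕ} (ha : ∀ j, a ≠ m + 2 * j + 1) :
    Function.Injective (consTuple a fun j => m + 2 * j + 1) := by
  rintro (_ | i) (_ | j) h
  · rfl
  · exact absurd h (ha j)
  · exact absurd h.symm (ha i)
  · simp only [consTuple] at h; omega

namespace TrFormula

/-- A formula that is negative if there are `N + 1` solutions `y ∈ D_R` of `ψ(y, z) < c` at mutual
distances greater than `ε`.  The variable `z_j` is `x_{m + 2j + 1}`. -/
noncomputable def separated (m : ℕ) (ψ : TrFormula) (N : ℕ) (R : {R : ℝ // 0 < R}) (ε c : ℝ) : TrFormula :=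
  .infs ⟨fun _ => R.1, fun _ => R.2⟩ (Finset.univ.toList.map fun k : Fin (N + 1) => m + 2 * (k : ℕ))
    (.conj ((Finset.univ.toList.map fun k : Fin (N + 1) =>
        (ψ.rename (consTuple (m + 2 * (k : ℕ)) fun j => m + 2 * j + 1)).addConst (-c)) ++
      ((Finset.univ.filter fun p : Fin (N + 1) × Fin (N + 1) => p.1 ≠ p.2).toList.map fun p =>
        (TrFormula.dist (.var (m + 2 * (p.1 : ℕ))) (.var (m + 2 * (p.2 : ℕ)))).neg.addConst ε)))

variable {M : Type u} [CStarAlgebra M] {τ : M → ℂ}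

/-- A maximum is below `κ` iff each entry is, so `κ` shifts every inequality. The bound `-1 < κ`
keeps clear of the floor of `conj`. -/
lemma eval_separated_lt (h : IsTraceLike τ) {m : ℕ} {ψ : TrFormula} {N : ℕ} {R : {R : ℝ // 0 < R}}
    {ε c κ : ℝ} (hκ : -1 < κ) (x : ℕ → M) :
    (separated m ψ N R ε c).eval τ x < κ ↔ ∃ y : Fin (N + 1) → M, (∀ k, ‖y k‖ ≤ R.1) ∧
      (∀ k, ψ.eval τ (consTuple (y k) fun j => x (m + 2 * j + 1)) < c + κ) ∧
      ∀ j k, j ≠ k → ε - κ < traceNorm2 τ (y j - y k) := by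
  have hinj : ∀ k : ℕ, Function.Injective (consTuple (m + 2 * k) fun j => m + 2 * j + 1) :=
    fun k => consTuple_injective fun j => by omega
  have hcomp : ∀ (w : ℕ → M) (k : ℕ), w ∘ consTuple (m + 2 * k) (fun j => m + 2 * j + 1) =
      consTuple (w (m + 2 * k)) fun j => w (m + 2 * j + 1) := fun w k =>
    (consTuple_map w _ _).symm
  rw [separated, eval_infs_lt h]
  simp only [eval_conj_lt hκ, List.mem_append, List.mem_map, Finset.mem_toList, Finset.mem_univ,
    true_and, Finset.mem_filter, Prod.exists, or_imp, forall_and, forall_exists_index, and_imp,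
    forall_apply_eq_imp_iff, eval_addConst, eval_rename (hinj _), hcomp, not_exists]
  constructor
  · rintro ⟨w, hw, hwR, hψ, hd⟩
    refine ⟨fun k => w (m + 2 * k), hwR, fun k => ?_, fun j k hjk => ?_⟩
    · have h1 := hψ k
      have h2 : (fun j => w (m + 2 * j + 1)) = fun j => x (m + 2 * j + 1) :=
        funext fun j => hw _ fun k => by omega
      rw [h2] at h1
      linarith
    · have := hd _ j k hjk rfl
      simp only [eval_addConst, eval_neg, TrFormula.eval, TrTerm.eval] at this
      linarith
  · rintro ⟨y, hyR, hψ, hd⟩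
    let w : ℕ → M := fun i => if hi : ∃ k : Fin (N + 1), m + 2 * (k : ℕ) = i then y hi.choose else x i
    have hwk : ∀ k : Fin (N + 1), w (m + 2 * k) = y k := by
      intro k
      have hi : ∃ k' : Fin (N + 1), m + 2 * (k' : ℕ) = m + 2 * k := ⟨k, rfl⟩
      have : hi.choose = k := Fin.ext (by have := hi.choose_spec; omega)
      simp only [w, dif_pos hi, this]
    have hwx : ∀ i, (∀ k : Fin (N + 1), ¬ m + 2 * (k : ℕ) = i) → w i = x i := fun i hi =>
      dif_neg fun ⟨k, hk⟩ => hi k hk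
    refine ⟨w, hwx, fun k => by rw [hwk]; exact hyR k, fun k => ?_, ?_⟩
    · have h2 : (fun j => w (m + 2 * j + 1)) = fun j => x (m + 2 * j + 1) :=
        funext fun j => hwx _ fun k => by omega
      rw [hwk, h2]
      linarith [hψ k]
    · rintro φ j k hjk rfl
      simp only [eval_addConst, eval_neg, TrFormula.eval, TrTerm.eval, hwk]
      linarith [hd j k hjk]

lemma eval_separated_nonneg (h : IsTraceLike τ) {m : ℕ} {ψ : TrFormula} {N : ℕ}
    {R : {R : ℝ // 0 < R}} {ε c : ℝ} {x : ℕ → M}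
    (hx : NoSeparatedSolutions τ ψ N R.1 ε c fun j => x (m + 2 * j + 1)) :
    0 ≤ (separated m ψ N R ε c).eval τ x := by
  by_contra! hlt
  obtain ⟨y, hy, hψ, hd⟩ := (eval_separated_lt h (by norm_num) x).1 hlt
  obtain ⟨j, k, hjk, hlt⟩ := hx y hy fun k => by simpa using hψ k
  have := hd j k hjk
  linarith

/-- Partial converse of `eval_separated_nonneg`. The condition there is closed; relaxing it to the
open `> -κ`, as a neighborhood of a type requires, only worsens the constants by `κ`. -/
lemma noSeparatedSolutions_of_lt_eval (h : IsTraceLike τ) {m : ℕ} {ψ : TrFormula} {N : ℕ}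
    {R : {R : ℝ // 0 < R}} {ε c κ : ℝ} (hκ : κ < 1) {x : ℕ → M}
    (hx : -κ < (separated m ψ N R ε c).eval τ x) {ε' : ℝ} (hε : ε + κ < ε') :
    NoSeparatedSolutions τ ψ N R.1 ε' (c - κ) fun j => x (m + 2 * j + 1) := by
  intro y hy hψ
  by_contra! hcon
  refine hx.not_gt ((eval_separated_lt h (by linarith) x).2
    ⟨y, hy, fun k => hψ k, fun j k hjk => ?_⟩)
  linarith [hcon j k hjk]

/-- The conjunction of `φ(z) < 0`, `ψ_i(x_i, z) < η_i`, and the approximate absence of separated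
solutions of `ψ_i(y, z) < 2 η_i`, for the `i ∈ F`. -/
noncomputable def extension (m : ℕ) (F : Finset ℕ) (ψ : ℕ → TrFormula) (N : ℕ → ℕ) (r : Radii) (ε : ℝ)
    (η κ : ℕ → ℝ) (φ : TrFormula) : TrFormula :=
  .conj (φ.rename (fun j => m + 2 * j + 1) ::
    ((F.toList.map fun i =>
      ((ψ i).rename (consTuple i fun j => m + 2 * j + 1)).addConst (-(η i))) ++
    F.toList.map fun i =>
      (separated m (ψ i) (N i) ⟨r.1 i, r.2 i⟩ ε (2 * η i)).neg.addConst (-(κ i))))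

lemma eval_extension_lt {m : ℕ} {F : Finset ℕ} (hF : ∀ i ∈ F, i < m) {ψ : ℕ → TrFormula}
    {N : ℕ → ℕ} {r : Radii} {ε : ℝ} {η κ : ℕ → ℝ} {φ : TrFormula} (x : ℕ → M) :
    (extension m F ψ N r ε η κ φ).eval τ x < 0 ↔ φ.eval τ (fun j => x (m + 2 * j + 1)) < 0 ∧
      ∀ i ∈ F, (ψ i).eval τ (consTuple (x i) fun j => x (m + 2 * j + 1)) < η i ∧
        -(κ i) < (separated m (ψ i) (N i) ⟨r.1 i, r.2 i⟩ ε (2 * η i)).eval τ x := by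
  have hinj : Function.Injective fun j => m + 2 * j + 1 := fun i j h => by
    simp only at h; omega
  rw [extension, eval_conj_lt (by norm_num)]
  simp only [List.mem_cons, List.mem_append, List.mem_map, Finset.mem_toList, or_imp, forall_and,
    forall_exists_index, and_imp, forall_apply_eq_imp_iff₂, forall_eq, eval_addConst, eval_neg,
    eval_rename hinj]
  refine and_congr Iff.rfl (and_congr (forall₂_congr fun i hi => ?_) (forall₂_congr fun i _ => ?_))
  · rw [eval_rename (consTuple_injective fun j => by have := hF i hi; omega),
      show x ∘ consTuple i (fun j => m + 2 * j + 1) = _ from (consTuple_map x _ _).symm,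
      ← sub_eq_add_neg, sub_neg]
  · constructor <;> intro h <;> linarith

end TrFormula

/-! ### Entropy of algebraic tuples -/

lemma exists_pos_forall_le {ι : Type*} (F : Finset ι) {δ : ι → ℝ} (h : ∀ i, 0 < δ i) :
    ∃ d > 0, ∀ i ∈ F, d ≤ δ i := by
  have h1 : ∀ᶠ d in 𝓝[>] (0 : ℝ), ∀ i ∈ F, d ≤ δ i := (Filter.eventually_all_finset F).2 fun i _ =>
    Filter.mem_of_superset (Ioo_mem_nhdsGT (h i)) fun d hd => hd.2.le
  obtain ⟨d, hd, h0⟩ := (h1.and self_mem_nhdsWithin).exists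
  exact ⟨d, h0, hd⟩

theorem entAt_le_Ent_of_isAlgebraicVia {U : Ultrafilter ℕ} (hU : ∀ n : ℕ, U ≠ pure n) {M : Type u}
    [CStarAlgebra M] [PartialOrder M] [StarOrderedRing M] [WStarAlgebra M] {τ : M →ₚ[ℂ] ℂ}
    (hτ : IsFaithfulNormalTracialState τ) {X Z : ℕ → M} (hXZ : ∀ i, IsAlgebraicVia τ Z (X i))
    (r : Radii) (F : Finset ℕ) {ε : ℝ} (hε : 0 < ε) :
    entAt U r F (3 * ε) {typeOf hτ X} ≤ Ent U {typeOf hτ Z} := by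
  by_cases hX : InDomain r X
  swap
  · rw [entAt_typeOf_eq_bot hU hτ hX]; exact bot_le
  have htr := hτ.isTraceLike
  choose ψ N η hη hψ hsep using fun i =>
    (hXZ i).exists_noSeparatedSolutions (r.2 i) (hX i) hε
  let s : Radii := ⟨fun j => ‖Z j‖ + 1, fun j => by positivity⟩
  have hZs : InDomain s Z := fun j => by simp [s]
  let m := F.sup id + 1
  have hFm : ∀ i ∈ F, i < m := fun i hi => Nat.lt_succ_of_le (Finset.le_sup (f := id) hi)
  let l := F.sup fun i => (ψ i).width
  choose δ' hδ' hcont using fun i =>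
    ((ψ i).bounded_and_uniform.{0} (consTuple (r.1 i) s.1)).2 (η i / 4) (by linarith [hη i])
  obtain ⟨δ, hδ, hδle⟩ := exists_pos_forall_le F fun i => half_pos (hδ' i)
  -- The three bounds give `κ < 1`, then `ε + κ < 3ε`, and finally `η + η/4 < 2η - κ`, which leaves
  -- room for the change of parameters.
  let κ : ℕ → ℝ := fun i => min (1 / 2) (min ε (η i / 2))
  have hκ : ∀ i, 0 < κ i := fun i => by have := hη i; positivity
  suffices h : entAt U r F (3 * ε) {typeOf hτ X} ≤ entAt U s (Finset.range l) δ {typeOf hτ Z} from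
    h.trans ((le_iSup₂_of_le (Finset.range l) δ (le_iSup (fun _ : 0 < δ => entAt U s (Finset.range l) δ {typeOf hτ Z}) hδ)).trans
      (le_iSup (fun s => entRadius U s {typeOf hτ Z}) s))
  refine entAt_le_of_forall hU (Fintype.card (∀ i : F, Fin (N i))) fun O hO hZO => ?_
  obtain ⟨φ, hφ, hφO⟩ := exists_formula_of_isOpen hO s (Set.singleton_subset_iff.1 hZO)
    ⟨M, inferInstance, inferInstance, inferInstance, inferInstance, τ, Z, hτ, hZs, rfl⟩
  let Φ := TrFormula.extension m F ψ N r ε η κ φ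
  -- A formula quantifies finitely many variables; these are all the parameters that `Φ` can
  -- mention.
  let L := (List.range Φ.width).map fun j => m + 2 * j + 1
  let s' : Radii := ⟨fun i => s.1 ((i - m) / 2), fun i => s.2 _⟩
  have hs' : ∀ j, s'.1 (m + 2 * j + 1) = s.1 j := fun j =>
    congrArg s.1 (by omega)
  refine ⟨_, isOpen_setOf_formula_lt (.infs s' L Φ) 0, ?_, fun n hn => ?_⟩
  · rw [Set.singleton_subset_iff]
    refine (TrFormula.eval_infs_lt htr s' L Φ X).2 ?_
    let w₀ : ℕ → M := fun i => if m < i ∧ (i - m) % 2 = 1 then Z ((i - m) / 2) else X i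
    have hw₀Z : ∀ j, w₀ (m + 2 * j + 1) = Z j := fun j => by
      simp only [w₀]
      rw [if_pos (by omega)]
      congr 1; omega
    have hw₀X : ∀ i, (∀ j, i ≠ m + 2 * j + 1) → w₀ i = X i := fun i hi => by
      refine if_neg fun h => hi ((i - m) / 2) ?_
      omega
    -- The witness must equal `X` off `L`, so it may differ from `w₀`, but only beyond the width of
    -- `Φ`.
    refine ⟨fun i => if i ∈ L then w₀ i else X i, fun i hi => if_neg hi, fun i hi => ?_, ?_⟩
    · simp only [if_pos hi]
      obtain ⟨j, -, rfl⟩ := List.mem_map.1 hi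
      rw [hw₀Z, hs']
      exact hZs j
    · rw [Φ.eval_congr htr (y := w₀), TrFormula.eval_extension_lt hFm]
      · simp only [hw₀Z]
        refine ⟨hφ, fun i hi => ⟨?_, (neg_lt_zero.2 (hκ i)).trans_le
          (TrFormula.eval_separated_nonneg htr ?_)⟩⟩
        · rw [hw₀X i fun j => by have := hFm i hi; omega]
          exact hψ i
        · simp only [hw₀Z]
          exact hsep i
      · intro i hi
        by_cases hiL : i ∈ L
        · simp [hiL]
        · simp only [if_neg hiL]
          refine (hw₀X i fun j hj => hiL (List.mem_map.2 ⟨j, List.mem_range.2 ?_, hj.symm⟩)).symm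
          omega
  · have : NeZero n := ⟨hn⟩
    have hn := isTraceLike_matTr n
    refine orbCoveringNumber_le_mul (s := s) (r := r) (N := N) (ψ := ψ) hδ (b := η)
      (c := fun i => 2 * η i - κ i) (fun W hW => hW.1) ?_ ?_
    · rintro x ⟨hx, μ, hμ, hμx⟩
      refine ⟨hx, ?_⟩
      rw [Set.mem_ofPred_eq, hμx] at hμ
      obtain ⟨w, hwx, hwL, hw⟩ := (TrFormula.eval_infs_lt hn s' L Φ x).1 hμ
      -- Off `L` the tuple `w` agrees with `x`, which need not respect the radii `s`; zeros at
      -- irrelevant indices put all the parameters into the box.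
      let w' : ℕ → Matrix (Fin n) (Fin n) ℂ := fun i => if i < m ∨ i < Φ.width then w i else 0
      have hww' : Φ.eval (matTr n) w = Φ.eval (matTr n) w' :=
        Φ.eval_congr hn fun i hi => by simp [w', hi]
      rw [hww', TrFormula.eval_extension_lt hFm] at hw
      let W : ℕ → Matrix (Fin n) (Fin n) ℂ := fun j => w' (m + 2 * j + 1)
      have hW : InDomain s W := by
        intro j
        by_cases hj : m + 2 * j + 1 < Φ.width
        · have : W j = w (m + 2 * j + 1) := by simp [W, w', hj]
          rw [this, ← hs' j]
          exact hwL _ (List.mem_map.2 ⟨j, List.mem_range.2 (by omega), rfl⟩)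
        · have : W j = 0 := by
            simp only [W, w']
            rw [if_neg (by omega)]
          rw [this, norm_zero]
          exact (s.2 j).le
      obtain ⟨ν, hνs, hν⟩ := exists_typeSpace_eq_formulaType_matTr n s hW
      refine ⟨W, ⟨hW, ν, hφO ν hνs (by rw [hν]; exact hw.1), hν⟩, fun i hi => ⟨?_, ?_⟩⟩
      · have hxi : w' i = x i := by
          rw [← hwx i fun hiL => ?_]
          · simp [w', hFm i hi]
          · obtain ⟨j, -, hj⟩ := List.mem_map.1 hiL
            have := hFm i hi
            omega
        rw [← hxi]
        exact (hw.2 i hi).1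
      · refine TrFormula.noSeparatedSolutions_of_lt_eval hn ?_ (hw.2 i hi).2 ?_
        · exact (min_le_left _ _).trans_lt (by norm_num)
        · have : κ i ≤ ε := (min_le_right _ _).trans (min_le_left _ _)
          linarith
    · intro i hi x W W' hx hW hW' hd hlt
      have hdom : ∀ {W : ℕ → Matrix (Fin n) (Fin n) ℂ}, InDomain s W →
          ∀ j, ‖consTuple x W j‖ ≤ consTuple (r.1 i) s.1 j := by
        rintro W hW (_ | j)
        · exact hx
        · exact hW j
      have h1 := hcont i _ _ hn _ _ (hdom hW) (hdom hW') fun j hj => by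
        rcases j with _ | j
        · simpa [consTuple, hn.zero] using (hδ' i).le
        · refine (hd j ?_).trans (by linarith [hδle i hi])
          have : (ψ i).width ≤ l := Finset.le_sup (f := fun i => (ψ i).width) hi
          omega
      have h2 : κ i ≤ η i / 2 := (min_le_right _ _).trans (min_le_right _ _)
      linarith [(abs_le.1 h1).1, hη i]

theorem Ent_le_of_isAlgebraicVia {U : Ultrafilter ℕ} (hU : ∀ n : ℕ, U ≠ pure n) {M : Type u}
    [CStarAlgebra M] [PartialOrder M] [StarOrderedRing M] [WStarAlgebra M] {τ : M →ₚ[ℂ] ℂ}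
    (hτ : IsFaithfulNormalTracialState τ) {X Z : ℕ → M} (hXZ : ∀ i, IsAlgebraicVia τ Z (X i)) :
    Ent U {typeOf hτ X} ≤ Ent U {typeOf hτ Z} := by
  refine iSup_le fun r => iSup₂_le fun F ε => iSup_le fun hε => ?_
  have := entAt_le_Ent_of_isAlgebraicVia hU hτ hXZ r F (ε := ε / 3) (by positivity)
  rwa [mul_div_cancel₀ _ three_ne_zero] at this

/-! ### Elements of generated subalgebras and common parameters -/

lemma exists_term_of_mem_adjoin {M : Type u} [CStarAlgebra M] {Z : ℕ → M} {a : M}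
    (ha : a ∈ StarAlgebra.adjoin ℂ (Set.range Z)) : ∃ t : TrTerm, t.eval Z = a := by
  induction ha using StarAlgebra.adjoin_induction with
  | mem x hx => obtain ⟨i, rfl⟩ := hx; exact ⟨.var i, rfl⟩
  | algebraMap c => exact ⟨.smul c .one, (Algebra.algebraMap_eq_smul_one c).symm⟩
  | add x y _ _ hx hy =>
    obtain ⟨s, rfl⟩ := hx
    obtain ⟨t, rfl⟩ := hy
    exact ⟨.add s t, rfl⟩
  | mul x y _ _ hx hy =>
    obtain ⟨s, rfl⟩ := hx
    obtain ⟨t, rfl⟩ := hy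
    exact ⟨.mul s t, rfl⟩
  | star x _ hx => obtain ⟨t, rfl⟩ := hx; exact ⟨.adj t, rfl⟩

section
variable {M : Type u} [CStarAlgebra M] [PartialOrder M] [StarOrderedRing M] {τ : M →ₚ[ℂ] ℂ}

/-- Evaluation at the vector `1` turns strong convergence into convergence in 2-norm. -/
lemma exists_traceNorm2_sub_lt_of_mem_sotClosure {S : Set M} {a : M} (ha : a ∈ sotClosure τ S)
    {ε : ℝ} (hε : 0 < ε) : ∃ b ∈ S, traceNorm2 τ (a - b) < ε := by
  have h1 := mem_closure_image (continuous_apply (τ.toPreGNS 1 : τ.GNS)).continuousAt ha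
  obtain ⟨_, ⟨_, ⟨b, hb, rfl⟩, rfl⟩, hlt⟩ := Metric.mem_closure_iff.1 h1 ε hε
  refine ⟨b, hb, ?_⟩
  beta_reduce at hlt
  rw [gnsStarAlgHom_apply_coe, gnsStarAlgHom_apply_coe, UniformSpace.Completion.dist_eq] at hlt
  rw [traceNorm2_sub_eq_dist]
  simpa using hlt

lemma subset_sotClosure (S : Set M) : S ⊆ sotClosure τ S := fun _ ha =>
  subset_closure (Set.mem_image_of_mem _ ha)

lemma mem_generatedWStar (Z : ℕ → M) (i : ℕ) : Z i ∈ generatedWStar τ Z :=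
  subset_sotClosure _ (StarAlgebra.subset_adjoin ℂ _ (Set.mem_range_self i))

/-- The compact set is `{a}`: a *-polynomial `t(Z)` within `ε` of `a` makes `d(x, t(Z))` approximate
`d(x, a)` uniformly in `x`. -/
lemma isAlgebraicVia_of_mem_generatedWStar {Z : ℕ → M} {a : M} (ha : a ∈ generatedWStar τ Z) :
    IsAlgebraicVia τ Z a := by
  refine ⟨{τ.toPreGNS a}, isCompact_singleton, rfl, fun r _ ε hε => ?_⟩
  obtain ⟨b, hb, hab⟩ := exists_traceNorm2_sub_lt_of_mem_sotClosure ha hε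
  obtain ⟨t, rfl⟩ := exists_term_of_mem_adjoin hb
  refine ⟨.dist (.var 0) (t.rename Nat.succ), fun x _ => ?_⟩
  have ht : (t.rename Nat.succ).eval (consTuple x Z) = t.eval Z := TrTerm.eval_rename _ _ t
  rw [traceNorm2_sub_eq_dist] at hab
  have hev : TrFormula.eval τ (.dist (.var 0) (t.rename Nat.succ)) (consTuple x Z) =
      dist (τ.toPreGNS x) (τ.toPreGNS (t.eval Z)) := by
    rw [← traceNorm2_sub_eq_dist, ← ht]; rfl
  rw [Metric.infDist_singleton, hev, dist_comm (τ.toPreGNS x), dist_comm (τ.toPreGNS x)]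
  exact (abs_dist_sub_le _ _ _).trans_lt hab

lemma isAlgebraicOver_of_mem {N : Set M} {a : M} (ha : a ∈ N) : IsAlgebraicOver τ N a := by
  refine ⟨{τ.toPreGNS a}, isCompact_singleton, rfl, fun r _ ε hε => ?_⟩
  refine ⟨.dist (.var 0) (.var 1), fun _ => a, fun _ => ha, fun x _ => ?_⟩
  beta_reduce
  rw [Metric.infDist_singleton, ← traceNorm2_sub_eq_dist]
  simpa [TrFormula.eval, TrTerm.eval, consTuple] using hε

/-- Countably many algebraic elements are algebraic via a common sequence of parameters. -/
lemma exists_isAlgebraicVia {N : Set M} {a : ℕ → M} (ha : ∀ k, IsAlgebraicOver τ N (a k)) :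
    ∃ W : ℕ → M, (∀ j, W j ∈ N) ∧ ∀ k, IsAlgebraicVia τ W (a k) := by
  choose A hA haA hdef using ha
  choose ψ Y hY hψ using fun k (q : ℕ) =>
    hdef k (q + 1) (by positivity) (1 / (q + 1)) (by positivity)
  -- Countably many radii and precisions suffice for each element, so pairing merges all parameter
  -- sequences into one. The renaming `σ` below selects the block for `k` and `q`.
  refine ⟨fun n => Y n.unpair.1.unpair.1 n.unpair.1.unpair.2 n.unpair.2, fun j => hY _ _ _,
    fun k => ⟨A k, hA k, haA k, fun r _ ε hε => ?_⟩⟩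
  obtain ⟨q₁, hq₁⟩ := exists_nat_ge r
  obtain ⟨q₂, hq₂⟩ := exists_nat_one_div_lt hε
  let q := max q₁ q₂
  have hr : r ≤ q + 1 := hq₁.trans <| by
    have : (q₁ : ℝ) ≤ q := by exact_mod_cast le_max_left _ _
    linarith
  have hε' : 1 / ((q : ℝ) + 1) < ε := (Nat.one_div_le_one_div (le_max_right _ _)).trans_lt hq₂
  let σ : ℕ → ℕ := consTuple 0 fun j => Nat.pair (Nat.pair k q) j + 1
  have hσ : Function.Injective σ := by
    rintro (_ | i) (_ | j) h
    · rfl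
    · exact absurd h.symm (Nat.succ_ne_zero _)
    · exact absurd h (Nat.succ_ne_zero _)
    · have := (Nat.pair_eq_pair.1 (Nat.succ_injective h)).2
      rw [this]
  refine ⟨(ψ k q).rename σ, fun x hx => ?_⟩
  rw [TrFormula.eval_rename hσ]
  refine (lt_of_eq_of_lt ?_ (hψ k q x (hx.trans hr))).trans hε'
  congr 3
  ext (_ | j)
  · rfl
  · simp [σ, consTuple]

end

theorem mainTheorem9 (U : Ultrafilter ℕ) (hU : ∀ n : ℕ, U ≠ pure n)
    {M : Type u} [CStarAlgebra M] [PartialOrder M] [StarOrderedRing M] [WStarAlgebra M]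
    (τ : M →ₚ[ℂ] ℂ) (hτ : IsFaithfulNormalTracialState τ) :
    (∀ (X : ℕ → M) (Y : M), IsAlgebraicOver τ (generatedWStar τ X) Y →
      Ent U {typeOf hτ (consTuple Y X)} = Ent U {typeOf hτ X}) ∧
    (∀ N : StarSubalgebra ℂ M, IsWStarSubalgebra τ N →
      EntIn U hτ (acl τ (N : Set M)) = EntIn U hτ (N : Set M)) := by
  refine ⟨fun X Y hY => le_antisymm ?_ ?_, fun N _ => le_antisymm ?_ ?_⟩
  -- The common parameters `W` lie in the algebra generated by `X` and are algebraic via `X`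
  -- themselves, so the inequality is used twice.
  · obtain ⟨W, hW, hvia⟩ := exists_isAlgebraicVia (τ := τ) (N := generatedWStar τ X)
      (a := consTuple Y X) fun k => by
        rcases k with _ | k
        · exact hY
        · exact isAlgebraicOver_of_mem (mem_generatedWStar X k)
    exact (Ent_le_of_isAlgebraicVia hU hτ hvia).trans (Ent_le_of_isAlgebraicVia hU hτ fun i =>
      isAlgebraicVia_of_mem_generatedWStar (hW i))
  · exact Ent_le_of_isAlgebraicVia hU hτ fun i =>
      isAlgebraicVia_of_mem_generatedWStar (mem_generatedWStar (consTuple Y X) (i + 1))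
  · refine iSup₂_le fun X hX => ?_
    obtain ⟨W, hW, hvia⟩ := exists_isAlgebraicVia hX
    exact (Ent_le_of_isAlgebraicVia hU hτ hvia).trans
      (le_iSup₂ (f := fun (W : ℕ → M) (_ : ∀ j, W j ∈ (N : Set M)) => Ent U {typeOf hτ W}) W hW)
  · exact iSup₂_le fun X hX => le_iSup₂ (f := fun (W : ℕ → M)
      (_ : ∀ j, W j ∈ acl τ (N : Set M)) => Ent U {typeOf hτ W}) X
      fun j => isAlgebraicOver_of_mem (hX j)
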